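/- Let $q\ge 2$, $n\ge 1$ be integers and let $\mathcal Q=\mathbb Z/q\mathbb Z$. Vectors of $\mathcal Q^{2,n}$ consist of $n$ blocks of length $2$. The shape of a vector is $(e_1,e_2)$, where $e_i$ is the number of blocks whose rightmost nonzero entry is in position $i$; its ordered weight is $e_1+2e_2$, and the ordered distance of $x,y$ is the ordered weight of $x-y$. Let $v_e$ be the number of vectors of shape $e$ and $\Delta_{2,n}=\{(e_1,e_2)\in\mathbb Z_{\ge0}^2: e_1+e_2\le n\}$. A $(2n,M,d)$ code is a set $C\subset\mathcal Q^{2,n}$ of $M$ vectors, any two distinct ones of which are at ordered distance at least $d$. A set of coordinates is left-adjusted if with the second coordinate of a block it contains the first one. For $0\le t\le 2n$, a $(t,n,2,q)$ ordered orthogonal array (OOA) of size $M$ is a set $A\subset \mathcal Q^{2,n}$ of $M$ vectors for which there is an integer $\theta\ge 1$ such that the projection of $A$ on any left-adjusted set of $t$ coordinates contains each of the $q^t$ possible rows exactly $\theta$ times. For an integer $s\ge 0$ and real $N$ let $$k_s(N,x)=\sum_{l=0}^{s}(-1)^l(q-1)^{s-l}\binom{x}{l}\binom{N-x}{s-l}$$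 be the Krawtchouk polynomial in $x$ (with generalized binomial coefficients), let $x_1(N,s)$ be its smallest real root if it has one, and put $x_1(N,0)=+\infty$. Let $s_1\ge 1$, $s_2\ge 0$ be integers with $\{(s_1-1,s_2+1),(s_1,s_2)\}\subset\Delta_{2,n}$, and put $s=(s_1-1,s_2)$. Then there are real numbers $\alpha,\beta$ such that $$\beta=x_1(n-s_2,s_1),\qquad x_1(n-\beta,s_2+1)<\alpha<x_1(n-\beta,s_2),\qquad \frac{k_{s_2+1}(n-\beta,\alpha)}{k_{s_2}(n-\beta,\alpha)}=-\frac{k_{s_2+1}(n-\beta,0)}{k_{s_2}(n-\beta,0)}.$$ For any such $\alpha,\beta$ and any integer $d$ with $\alpha+2\beta\le d$: (1) every $(2n,M,d)$ code satisfies $$M\le \frac{4(n-\beta-s_2)(n-s_2-s_1+1)^2(q-1)^3(\alpha+2\beta)}{q^3\alpha^2\beta^2}\,v_s;$$ (2) every $(d-1,n,2,q)$ OOA of size $M$ satisfies $$M\ge \frac{q^{2n}}{v_s}\cdot\frac{q^3\alpha^2\beta^2}{4(n-\beta-s_2)(n-s_2-s_1+1)^2(q-1)^3(\alpha+2\beta)}.$$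 -/

import Mathlib

namespace NRT

/-- The space of vectors made of `n` blocks of length `r` over the alphabet `ZMod q`. -/
abbrev Space (q n r : ℕ) : Type := Fin n → Fin r → ZMod q

/-- The position, counted from 1, of the rightmost nonzero entry of a block; `0` for the zero
block. -/
def blockWeight {q r : ℕ} (b : Fin r → ZMod q) : ℕ :=
  (Finset.univ.filter fun j : Fin r => b j ≠ 0).sup fun j => (j : ℕ) + 1

/-- The shape `(e_1, …, e_r)` of a vector: `e_i` (stored at index `i - 1`) is the number of blocks
whose rightmost nonzero entry is in position `i`. -/
def shape {q n r : ℕ} (x : Space q n r) : Fin r → ℕ :=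
  fun j => (Finset.univ.filter fun i : Fin n => blockWeight (x i) = (j : ℕ) + 1).card

/-- The ordered weight `∑ i * e_i` of a vector of shape `e`. -/
def weight {q n r : ℕ} (x : Space q n r) : ℕ :=
  ∑ j : Fin r, ((j : ℕ) + 1) * shape x j

/-- The ordered distance. -/
def orderedDist {q n r : ℕ} (x y : Space q n r) : ℕ := weight (x - y)

/-- The set `Δ_{r,n}` of shapes: `r`-tuples of nonnegative integers with sum at most `n`. -/
def Shapes (r n : ℕ) : Set (Fin r → ℕ) := {e | ∑ j, e j ≤ n}

/-- The number `v_e` of vectors of shape `e`. -/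
noncomputable def valency (q n : ℕ) {r : ℕ} (e : Fin r → ℕ) : ℕ :=
  Nat.card {x : Space q n r // shape x = e}

/-- An `(nr, M, d)` ordered code. -/
def IsCode {q n r : ℕ} (C : Finset (Space q n r)) (M d : ℕ) : Prop :=
  C.card = M ∧ ∀ x ∈ C, ∀ y ∈ C, x ≠ y → d ≤ orderedDist x y

/-- A set of coordinates is left-adjusted if with each coordinate it contains all the coordinates
to the left of it in the same block. -/
def LeftAdjusted {n r : ℕ} (I : Finset (Fin n × Fin r)) : Prop :=
  ∀ (i : Fin n) (j j' : Fin r), j' ≤ j → (i, j) ∈ I → (i, j') ∈ I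

/-- A `(t, n, r, q)` ordered orthogonal array of size `M` : the projection of `A` on any
left-adjusted set `I` of `t ≤ nr` coordinates contains every row the same number `θ ≥ 1` of times.
The rows on `I` are given as the restrictions to `I` of full vectors `y`. -/
def IsOOA {q n r : ℕ} (A : Finset (Space q n r)) (t M : ℕ) : Prop :=
  A.card = M ∧ t ≤ n * r ∧
    ∃ θ : ℕ, 0 < θ ∧ ∀ I : Finset (Fin n × Fin r), LeftAdjusted I → I.card = t →
      ∀ y : Space q n r, (A.filter fun x => ∀ p ∈ I, x p.1 p.2 = y p.1 p.2).card = θ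

/-- The univariate Krawtchouk polynomial `k_s(N, x)` with real parameter `N`. -/
noncomputable def krawtchouk (q s : ℕ) (N x : ℝ) : ℝ :=
  ∑ l ∈ Finset.range (s + 1),
    (-1) ^ l * ((q : ℝ) - 1) ^ (s - l) * Ring.choose x l * Ring.choose (N - x) (s - l)

/-- `x` is the smallest root `x_1(N, s)` of `k_s(N, ·)`. -/
def IsFirstRoot (q s : ℕ) (N x : ℝ) : Prop :=
  IsLeast {z : ℝ | krawtchouk q s N z = 0} x

/-- The point `a = (α, β)` attached to `(s₁, s₂)`:
`β = x_1(n - s₂, s₁)`, `x_1(n - β, s₂ + 1) < α < x_1(n - β, s₂)`, and `W α = - W 0` for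
`W x = k_{s₂+1}(n - β, x) / k_{s₂}(n - β, x)`.
The upper bound on `α` is written so that it is void for `s₂ = 0`, when `k_0 = 1` has no roots
(that is, `x_1(·, 0) = ∞`). -/
structure IsPoint (q n s₁ s₂ : ℕ) (α β : ℝ) : Prop where
  beta_root : IsFirstRoot q s₁ ((n : ℝ) - s₂) β
  lt_alpha : ∃ x, IsFirstRoot q (s₂ + 1) ((n : ℝ) - β) x ∧ x < α
  alpha_lt : ∀ x, IsFirstRoot q s₂ ((n : ℝ) - β) x → α < x
  balance : krawtchouk q (s₂ + 1) ((n : ℝ) - β) α / krawtchouk q s₂ ((n : ℝ) - β) α =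
    -(krawtchouk q (s₂ + 1) ((n : ℝ) - β) 0 / krawtchouk q s₂ ((n : ℝ) - β) 0)

end NRT

/-! Both bounds come from one linear programming certificate: functions `f ≥ 0` and `F = fourier f`
with `F z ≤ 0` whenever `weight z ≥ α + 2β`. Positivity of `f` and the sign of `F` give `M ≤ F 0 / f
0` for codes (`code_bound`) and, dually, `M ≥ q ^ (2n) f 0 / F 0` for arrays (`ooa_bound`).

The certificate is spectral. Averaging over whole blocks and over first entries of blocks
(`blockAvg`) is a convolution operator which on the Fourier side multiplies by `2n - weight z`
(`fourier_blockAvg`). Suppose `c ≥ 0` satisfies `h = blockAvg c - l c ≥ 0` with `l = 2n - (α + 2β)`.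
Then `f = c * h` (convolution) is nonnegative, and its transform is `(α + 2β - weight z) (fourier c
z) ^ 2`, which has the required sign.

On functions of the shape the operator becomes `shapeOp`. Bivariate Krawtchouk values at the real
point `(α, β)`, divided by the valencies, form an eigenfunction with eigenvalue `l` away from the
boundary `i + j = n` (`shapeOp_bivariate`). The function `c` is this eigenfunction cut off to
`Region`, where it is positive. Neighbours dropped in rows `j ≤ s₂` have nonpositive values, so
dropping them only increases `h`. Dropping row `s₂ + 1` contributes an amount fixed by the balance
equation for `α` (`defect_last`).

It remains to estimate `F 0 = (α + 2β) (∑ c) ^ 2` from above, by comparing rows and using a closed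
form for partial sums of Krawtchouk values (`sum_cutoff_le`), and `f 0 = ∑ c h` from below, by its
part on the single shape `(s₁ - 1, s₂)`. -/

namespace NRT

/-! ### Krawtchouk polynomials with real parameter, via generating functions. -/

open PowerSeries

/-- The binomial series `(1 + t X) ^ x`. -/
noncomputable def binSeries (t x : ℝ) : ℝ⟦X⟧ := PowerSeries.mk fun m => t ^ m * Ring.choose x m

lemma succ_mul_choose (x : ℝ) (l : ℕ) :
    ((l : ℝ) + 1) * Ring.choose x (l + 1) = (x - l) * Ring.choose x l := by
  have h := Ring.choose_smul_choose x (Nat.le_succ l)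
  simp only [Nat.succ_eq_add_one, Nat.choose_succ_self_right, Nat.add_sub_cancel_left,
    Ring.choose_one_right, nsmul_eq_mul] at h
  push_cast at h
  rw [h]; ring

lemma derivative_binSeries (t x : ℝ) :
    (1 + C t * X) * d⁄dX ℝ (binSeries t x) = C (t * x) * binSeries t x := by
  ext m
  rw [add_mul, one_mul, mul_assoc, map_add, coeff_C_mul, coeff_C_mul]
  have h := succ_mul_choose x m
  rcases m with _ | m
  · simp only [coeff_derivative, coeff_zero_X_mul, binSeries, coeff_mk]
    simp
  · simp only [coeff_derivative, coeff_succ_X_mul, binSeries, coeff_mk]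
    push_cast at h ⊢
    linear_combination t ^ (m + 2) * h

lemma binSeries_add_one (t x : ℝ) :
    binSeries t (x + 1) = (1 + C t * X) * binSeries t x := by
  ext m
  rw [add_mul, one_mul, mul_assoc, map_add, coeff_C_mul]
  rcases m with _ | m
  · simp [binSeries]
  · simp only [coeff_succ_X_mul, binSeries, coeff_mk, Ring.choose_succ_succ]
    ring

/-- The generating function of the Krawtchouk polynomials. -/
noncomputable def krawtchoukSeries (q : ℕ) (N x : ℝ) : ℝ⟦X⟧ :=
  binSeries (-1) x * binSeries ((q : ℝ) - 1) (N - x)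

lemma coeff_krawtchoukSeries (q s : ℕ) (N x : ℝ) :
    coeff s (krawtchoukSeries q N x) = krawtchouk q s N x := by
  rw [krawtchoukSeries, coeff_mul, Finset.Nat.sum_antidiagonal_eq_sum_range_succ_mk, krawtchouk]
  refine Finset.sum_congr rfl fun l _ => ?_
  simp only [binSeries, coeff_mk]
  ring

@[simp] lemma krawtchouk_zero (q : ℕ) (N x : ℝ) : krawtchouk q 0 N x = 1 := by
  simp [krawtchouk]

lemma krawtchouk_one (q : ℕ) (N x : ℝ) : krawtchouk q 1 N x = ((q : ℝ) - 1) * N - q * x := by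
  simp [krawtchouk, Finset.sum_range_succ]
  ring

/-- Raising `N` by one multiplies the generating function by `1 + (q - 1) X`. -/
lemma krawtchouk_succ_add_one (q s : ℕ) (N x : ℝ) :
    krawtchouk q (s + 1) (N + 1) x =
      krawtchouk q (s + 1) N x + ((q : ℝ) - 1) * krawtchouk q s N x := by
  have h : krawtchoukSeries q (N + 1) x =
      krawtchoukSeries q N x + C ((q : ℝ) - 1) * (X * krawtchoukSeries q N x) := by
    rw [krawtchoukSeries, show N + 1 - x = (N - x) + 1 by ring, binSeries_add_one,
      krawtchoukSeries]
    ring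
  have h2 := congrArg (coeff (s + 1)) h
  rwa [map_add, coeff_C_mul, coeff_succ_X_mul, coeff_krawtchoukSeries, coeff_krawtchoukSeries,
    coeff_krawtchoukSeries] at h2

/-- The two binomial factors satisfy first-order differential equations, so their product `K`
satisfies one with polynomial coefficient `(1 - X) (1 + (q - 1) X)` in front of `K'`. Comparing
coefficients gives the three-term recurrence. -/
lemma krawtchouk_add_two (q s : ℕ) (N x : ℝ) :
    ((s : ℝ) + 2) * krawtchouk q (s + 2) N x =
      (((q : ℝ) - 1) * N - q * x - ((q : ℝ) - 2) * (s + 1)) * krawtchouk q (s + 1) N x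
        - ((q : ℝ) - 1) * (N - s) * krawtchouk q s N x := by
  set t : ℝ := (q : ℝ) - 1 with ht
  set K := krawtchoukSeries q N x with hK
  have h : d⁄dX ℝ K + C (t - 1) * (X * d⁄dX ℝ K) - C t * (X * (X * d⁄dX ℝ K)) =
      C (t * N - (t + 1) * x) * K - C (t * N) * (X * K) := by
    have hA := derivative_binSeries (-1) x
    have hB := derivative_binSeries t (N - x)
    have hd : d⁄dX ℝ K = binSeries (-1) x * d⁄dX ℝ (binSeries t (N - x)) +
        binSeries t (N - x) * d⁄dX ℝ (binSeries (-1) x) := by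
      rw [hK, krawtchoukSeries, Derivation.leibniz]; rfl
    rw [hd, hK, krawtchoukSeries]
    simp only [map_sub, map_add, map_mul, map_one, map_neg] at hA hB ⊢
    linear_combination (1 - X) * binSeries (-1) x * hB +
      (1 + C t * X) * binSeries t (N - x) * hA
  obtain ⟨u, hu⟩ : ∃ u, u = t - 1 := ⟨_, rfl⟩
  obtain ⟨w, hw⟩ : ∃ w, w = t * N - (t + 1) * x := ⟨_, rfl⟩
  rw [← hu, ← hw] at h
  have h2 := congrArg (coeff (s + 1)) h
  rcases s with _ | s
  · simp only [map_add, map_sub, coeff_C_mul, coeff_succ_X_mul, coeff_zero_X_mul,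
      coeff_derivative] at h2
    simp only [hK, coeff_krawtchoukSeries] at h2
    push_cast at h2 ⊢
    subst hu hw
    rw [ht] at h2
    linear_combination h2
  · simp only [map_add, map_sub, coeff_C_mul, coeff_succ_X_mul, coeff_derivative] at h2
    simp only [hK, coeff_krawtchoukSeries] at h2
    push_cast at h2 ⊢
    subst hu hw
    rw [ht] at h2
    linear_combination h2

/-- The three-term recurrence telescopes. This closed form gives positivity for `x ≤ 0`, the ratio
`k_{s+1} / k_s` at `0`, and the total mass of the cut-off eigenfunction. -/
lemma sum_krawtchouk (q s : ℕ) (N x : ℝ) :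
    q * x * ∑ j ∈ Finset.range (s + 1), krawtchouk q j N x =
      ((q : ℝ) - 1) * (N - s) * krawtchouk q s N x - (s + 1) * krawtchouk q (s + 1) N x := by
  induction s with
  | zero => simp [krawtchouk_one]
  | succ s ih =>
    rw [Finset.sum_range_succ, mul_add, ih]
    push_cast
    linear_combination krawtchouk_add_two q s N x

lemma krawtchouk_add_one_combination (q s : ℕ) (N x : ℝ) :
    (N + 1 - s) * krawtchouk q s (N + 1) x + (s + 1) * krawtchouk q (s + 1) (N + 1) x =
      q * (N + 1 - x) * krawtchouk q s N x := by
  rcases s with _ | s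
  · simp [krawtchouk_one]; ring
  · rw [krawtchouk_succ_add_one, krawtchouk_succ_add_one]
    push_cast
    linear_combination krawtchouk_add_two q s N x

/-! ### Positivity and smallest roots. -/

lemma continuous_krawtchouk (q s : ℕ) (N : ℝ) : Continuous (krawtchouk q s N) := by
  induction s using Nat.twoStepInduction with
  | zero => simpa only [funext (krawtchouk_zero q N)] using continuous_const
  | one => rw [funext (krawtchouk_one q N)]; fun_prop
  | more s h0 h1 =>
    have : krawtchouk q (s + 2) N = fun x => ((s : ℝ) + 2)⁻¹ *
        ((((q : ℝ) - 1) * N - q * x - ((q : ℝ) - 2) * (s + 1)) * krawtchouk q (s + 1) N x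
        - ((q : ℝ) - 1) * (N - s) * krawtchouk q s N x) := by
      funext x
      rw [← krawtchouk_add_two]
      field_simp
    rw [this]
    fun_prop

/-- Strong induction through `sum_krawtchouk`: for `x ≤ 0` its left side is nonpositive, which
forces `k_{s+1}` to be positive when the earlier values are. -/
lemma krawtchouk_pos_of_nonpos {q : ℕ} (hq : 2 ≤ q) {N x : ℝ} (hx : x ≤ 0) (s : ℕ)
    (hs : (s : ℝ) < N + 1) : 0 < krawtchouk q s N x := by
  have hq' : (2 : ℝ) ≤ q := by exact_mod_cast hq
  induction s using Nat.strong_induction_on with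
  | _ s ih =>
    rcases s with _ | s
    · simp
    · push_cast at hs
      have hsum : 0 ≤ ∑ j ∈ Finset.range (s + 1), krawtchouk q j N x := by
        refine Finset.sum_nonneg fun j hj => (ih j (Finset.mem_range.1 hj) ?_).le
        have : (j : ℝ) ≤ s := by exact_mod_cast Nat.lt_succ_iff.1 (Finset.mem_range.1 hj)
        linarith
      have h1 : 0 < ((q : ℝ) - 1) * (N - s) * krawtchouk q s N x :=
        mul_pos (mul_pos (by linarith) (by linarith)) (ih s (Nat.lt_succ_self s) (by linarith))
      have h2 : q * x * ∑ j ∈ Finset.range (s + 1), krawtchouk q j N x ≤ 0 :=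
        mul_nonpos_of_nonpos_of_nonneg (mul_nonpos_of_nonneg_of_nonpos (by linarith) hx) hsum
      have h3 := sum_krawtchouk q s N x
      have h4 : 0 < ((s : ℝ) + 1) * krawtchouk q (s + 1) N x := by linarith
      exact pos_of_mul_pos_right h4 (by positivity)

lemma exists_isLeast_root {f : ℝ → ℝ} (hf : Continuous f) (hneg : ∀ x ≤ 0, 0 < f x) {b : ℝ}
    (hb : f b ≤ 0) :
    ∃ r, 0 < r ∧ r ≤ b ∧ IsLeast {z | f z = 0} r ∧ ∀ x < r, 0 < f x := by
  have hb0 : 0 ≤ b := by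
    by_contra h
    exact (hneg b (not_le.1 h).le).not_ge hb
  obtain ⟨z, ⟨-, hzb⟩, hz⟩ := intermediate_value_Icc' hb0 hf.continuousOn
    (show (0 : ℝ) ∈ Set.Icc (f b) (f 0) from ⟨hb, (hneg 0 le_rfl).le⟩)
  have hbdd : BddBelow {z | f z = 0} := ⟨0, fun y hy => by
    by_contra h
    exact (hneg y (not_le.1 h).le).ne' hy⟩
  have hmem := (isClosed_eq hf continuous_const).csInf_mem ⟨z, hz⟩ hbdd
  refine ⟨sInf {z | f z = 0}, ?_, (csInf_le hbdd hz).trans hzb, ⟨hmem, fun y hy => csInf_le hbdd hy⟩,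
    ?_⟩
  · by_contra h
    exact (hneg _ (not_lt.1 h)).ne' hmem
  · intro x hx
    by_contra h
    rcases le_total x 0 with hx0 | hx0
    · exact h (hneg x hx0)
    obtain ⟨y, ⟨-, hyx⟩, hy⟩ := intermediate_value_Icc' hx0 hf.continuousOn
      (show (0 : ℝ) ∈ Set.Icc (f x) (f 0) from ⟨not_lt.1 h, (hneg 0 le_rfl).le⟩)
    exact ((csInf_le hbdd hy).trans hyx).not_gt hx

/-- The Krawtchouk polynomials `k_1, …, k_{s+1}` with parameter `N > s` have decreasing, positive
smallest roots. -/
lemma exists_isFirstRoot {q : ℕ} (hq : 2 ≤ q) {N : ℝ} (s : ℕ) (hs : (s : ℝ) < N) :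
    ∃ r, 0 < r ∧ IsFirstRoot q (s + 1) N r ∧ (∀ x ≤ r, ∀ i ≤ s, 0 < krawtchouk q i N x) ∧
      ∀ x < r, 0 < krawtchouk q (s + 1) N x := by
  have hq' : (2 : ℝ) ≤ q := by exact_mod_cast hq
  induction s with
  | zero =>
    obtain ⟨r, h0, -, hr, hlt⟩ := exists_isLeast_root (continuous_krawtchouk q 1 N)
      (fun x hx => krawtchouk_pos_of_nonpos hq hx 1 (by push_cast at hs ⊢; linarith)) (b := N)
      (by rw [krawtchouk_one]; push_cast at hs; linarith)
    refine ⟨r, h0, hr, fun x _ i hi => ?_, hlt⟩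
    obtain rfl : i = 0 := by omega
    simp
  | succ s ih =>
    push_cast at hs
    obtain ⟨r, h0, hr, hle, hlt⟩ := ih (by linarith)
    have hroot : krawtchouk q (s + 1) N r = 0 := hr.1
    -- At the root `r` of `k_{s+1}` the recurrence loses its middle term, and `k_{s+2}` takes the
    -- sign opposite to `k_s`; hence `k_{s+2}` vanishes at or before `r`.
    have hneg : krawtchouk q (s + 2) N r ≤ 0 := by
      have h1 := krawtchouk_add_two q s N r
      rw [hroot, mul_zero, zero_sub] at h1
      have h2 : 0 ≤ ((q : ℝ) - 1) * (N - s) * krawtchouk q s N r :=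
        mul_nonneg (mul_nonneg (by linarith) (by linarith)) (hle r le_rfl s le_rfl).le
      by_contra h
      have h3 : 0 < ((s : ℝ) + 2) * krawtchouk q (s + 2) N r :=
        mul_pos (by positivity) (not_le.1 h)
      linarith
    obtain ⟨r', h0', hr'r, hr', hlt'⟩ := exists_isLeast_root (continuous_krawtchouk q (s + 2) N)
      (fun x hx => krawtchouk_pos_of_nonpos hq hx (s + 2) (by push_cast; linarith)) hneg
    have hr'lt : r' < r := by
      refine lt_of_le_of_ne hr'r fun h => ?_
      have h1 := krawtchouk_add_two q s N r
      have hroot' : krawtchouk q (s + 2) N r' = 0 := hr'.1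
      rw [hroot, ← h, hroot', h, mul_zero, mul_zero, zero_sub] at h1
      have h2 : 0 < ((q : ℝ) - 1) * (N - s) * krawtchouk q s N r :=
        mul_pos (mul_pos (by linarith) (by linarith)) (hle r le_rfl s le_rfl)
      linarith
    refine ⟨r', h0', hr', fun x hx i hi => ?_, hlt'⟩
    rcases Nat.lt_or_ge i (s + 1) with h | h
    · exact hle x (hx.trans hr'lt.le) i (Nat.lt_succ_iff.1 h)
    · obtain rfl : i = s + 1 := by omega
      exact hlt x (hx.trans_lt hr'lt)

lemma IsFirstRoot.unique {q s : ℕ} {N x y : ℝ} (hx : IsFirstRoot q s N x)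
    (hy : IsFirstRoot q s N y) : x = y := IsLeast.unique hx hy

lemma IsFirstRoot.pos_of_le {q s : ℕ} {N r : ℝ} (hr : IsFirstRoot q (s + 1) N r) (hq : 2 ≤ q)
    (hs : (s : ℝ) < N) {x : ℝ} (hx : x ≤ r) {i : ℕ} (hi : i ≤ s) : 0 < krawtchouk q i N x := by
  obtain ⟨r', -, hr', hle, -⟩ := exists_isFirstRoot hq s hs
  obtain rfl := hr.unique hr'
  exact hle x hx i hi

lemma IsFirstRoot.pos {q s : ℕ} {N r : ℝ} (hr : IsFirstRoot q (s + 1) N r) (hq : 2 ≤ q)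
    (hs : (s : ℝ) < N) : 0 < r := by
  obtain ⟨r', h0, hr', -, -⟩ := exists_isFirstRoot hq s hs
  rwa [hr.unique hr']

/-- Since `k_1` is still nonnegative at `r`, `q r ≤ (q - 1) N`. -/
lemma IsFirstRoot.lt {q s : ℕ} {N r : ℝ} (hr : IsFirstRoot q (s + 1) N r) (hq : 2 ≤ q)
    (hs : (s : ℝ) < N) : r < N := by
  have hq' : (2 : ℝ) ≤ q := by exact_mod_cast hq
  have hN : 0 < N := lt_of_le_of_lt (Nat.cast_nonneg s) hs
  have h1 : 0 ≤ krawtchouk q 1 N r := by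
    rcases s with _ | s
    · exact (show krawtchouk q 1 N r = 0 from hr.1).ge
    · exact (hr.pos_of_le hq hs le_rfl (by omega)).le
  rw [krawtchouk_one] at h1
  by_contra h
  nlinarith [not_lt.1 h]


/-! ### The bivariate eigenfunction of the shape operator. -/

/-- The bivariate Krawtchouk polynomial of index `(i, j)` at the real point `(α, β)`. -/
noncomputable def bivariate (q n : ℕ) (α β : ℝ) (i j : ℕ) : ℝ :=
  (q : ℝ) ^ j * krawtchouk q j ((n : ℝ) - β) α * krawtchouk q i ((n : ℝ) - j) β

/-- The indices `(i, j)` with `j ≤ s₂` for which `k_0, …, k_i` with parameter `n - j` are all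
positive at `β`. -/
def Region (q n s₂ : ℕ) (β : ℝ) (i j : ℕ) : Prop :=
  j ≤ s₂ ∧ i + j ≤ n ∧ ∀ i' ≤ i, 0 < krawtchouk q i' ((n : ℝ) - j) β

/-- The action on functions of the shape of averaging over the blocks and over the first entries
of the blocks. -/
noncomputable def shapeOp (q n : ℕ) (φ : ℕ → ℕ → ℝ) (i j : ℕ) : ℝ :=
  ((n : ℝ) - i - j) * (((q : ℝ)⁻¹ ^ 2 + (q : ℝ)⁻¹) * (φ i j + ((q : ℝ) - 1) * φ (i + 1) j)
      + (q : ℝ)⁻¹ * ((q : ℝ) - 1) * φ i (j + 1))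
    + i * (((q : ℝ)⁻¹ ^ 2 + (q : ℝ)⁻¹) * (φ (i - 1) j + ((q : ℝ) - 1) * φ i j)
      + (q : ℝ)⁻¹ * ((q : ℝ) - 1) * φ (i - 1) (j + 1))
    + j * ((q : ℝ)⁻¹ ^ 2 * (φ i (j - 1) + ((q : ℝ) - 1) * φ (i + 1) (j - 1))
      + ((q : ℝ)⁻¹ * ((q : ℝ) - 1) + 1) * φ i j)

lemma krawtchouk_row (q n i j : ℕ) (β : ℝ) :
    krawtchouk q (i + 1) ((n : ℝ) - j) β = krawtchouk q (i + 1) ((n : ℝ) - (j + 1 : ℕ)) β +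
      ((q : ℝ) - 1) * krawtchouk q i ((n : ℝ) - (j + 1 : ℕ)) β := by
  rw [← krawtchouk_succ_add_one]
  congr 1
  push_cast
  ring

/-- The recurrences that determine the numbers of vectors of given shape. -/
structure IsValency (q n : ℕ) (v : ℕ → ℕ → ℝ) : Prop where
  pos : ∀ i j, i + j ≤ n → 0 < v i j
  left : ∀ i j, i + j ≤ n → ((i : ℝ) + 1) * v (i + 1) j = ((n : ℝ) - i - j) * ((q : ℝ) - 1) * v i j
  right : ∀ i j, i + j ≤ n →
    ((j : ℝ) + 1) * v i (j + 1) = ((n : ℝ) - i - j) * (q * ((q : ℝ) - 1)) * v i j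

section Eigen

variable {q n : ℕ} {v : ℕ → ℕ → ℝ} (hq : 2 ≤ q) (hv : IsValency q n v) (α β : ℝ)

include hv

lemma IsValency.diag {i j : ℕ} (h : i + 1 + j ≤ n) :
    ((j : ℝ) + 1) * v i (j + 1) = q * (i + 1) * v (i + 1) j := by
  have h1 := hv.left i j (by omega)
  have h2 := hv.right i j (by omega)
  linear_combination h2 - q * h1

/-- The three-term recurrence in `i` at the point `β`, with the valency ratios absorbing its
coefficients. At `i = 0` the truncated index `i - 1` is harmless because its factor is `0`. -/
lemma row_recurrence {i j : ℕ} (hij : i + j < n) :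
    ((q : ℝ) - 1) * ((n : ℝ) - i - j) * (bivariate q n α β (i + 1) j / v (i + 1) j)
      + i * (bivariate q n α β (i - 1) j / v (i - 1) j) =
    (((q : ℝ) - 1) * ((n : ℝ) - j) - q * β - ((q : ℝ) - 2) * i) *
      (bivariate q n α β i j / v i j) := by
  have h0 := hv.pos i j (by omega)
  have h1 := hv.pos (i + 1) j (by omega)
  have e1 : ((q : ℝ) - 1) * ((n : ℝ) - i - j) * (bivariate q n α β (i + 1) j / v (i + 1) j) =
      (i + 1) * bivariate q n α β (i + 1) j / v i j := by
    field_simp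
    linear_combination -bivariate q n α β (i + 1) j * hv.left i j (by omega)
  rw [e1]
  rcases i with _ | i
  · simp [bivariate, krawtchouk_one]
    ring
  · have h2 := hv.pos i j (by omega)
    have e2 : ((i + 1 : ℕ) : ℝ) * (bivariate q n α β (i + 1 - 1) j / v (i + 1 - 1) j) =
        ((n : ℝ) - i - j) * ((q : ℝ) - 1) * bivariate q n α β i j / v (i + 1) j := by
      rw [Nat.add_sub_cancel]
      field_simp
      push_cast
      linear_combination bivariate q n α β i j * hv.left i j (by omega)
    rw [e2, ← add_div, mul_div_assoc', div_left_inj' h0.ne']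
    have h3 := krawtchouk_add_two q i ((n : ℝ) - j) β
    simp only [bivariate]
    push_cast
    linear_combination (q : ℝ) ^ j * krawtchouk q j ((n : ℝ) - β) α * h3

/-- After division by the valencies the left side is the combination in
`krawtchouk_add_one_combination`, which moves the parameter from `n - j` to `n - (j + 1)` and
produces the factor `n - β - j` needed for the recurrence in `α`. -/
lemma lower_right {i j : ℕ} (hij : i + (j + 1) < n) :
    ((j : ℝ) + 1) * (bivariate q n α β i j / v i j
      + ((q : ℝ) - 1) * (bivariate q n α β (i + 1) j / v (i + 1) j)) =
    q * ((q : ℝ) - 1) * (q : ℝ) ^ (j + 1) * krawtchouk q j ((n : ℝ) - β) α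
      * (((n : ℝ) - β - j) * krawtchouk q i ((n : ℝ) - (j + 1 : ℕ)) β) / v i (j + 1) := by
  have h0 := hv.pos i j (by omega)
  have h1 := hv.pos (i + 1) j (by omega)
  have h2 := hv.pos i (j + 1) (by omega)
  have e1 : ((j : ℝ) + 1) * (bivariate q n α β i j / v i j) =
      ((n : ℝ) - i - j) * (q * ((q : ℝ) - 1)) * bivariate q n α β i j / v i (j + 1) := by
    field_simp
    linear_combination bivariate q n α β i j * hv.right i j (by omega)
  have e2 : ((j : ℝ) + 1) * (bivariate q n α β (i + 1) j / v (i + 1) j) =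
      q * (i + 1) * bivariate q n α β (i + 1) j / v i (j + 1) := by
    field_simp
    linear_combination bivariate q n α β (i + 1) j * hv.diag (i := i) (j := j) (by omega)
  have h3 := krawtchouk_add_one_combination q i ((n : ℝ) - (j + 1 : ℕ)) β
  rw [show (n : ℝ) - (j + 1 : ℕ) + 1 = (n : ℝ) - j by push_cast; ring] at h3
  rw [mul_add, mul_left_comm, e1, e2, mul_div_assoc', ← add_div]
  congr 1
  simp only [bivariate]
  linear_combination q * ((q : ℝ) - 1) * (q : ℝ) ^ j * krawtchouk q j ((n : ℝ) - β) α * h3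

include hq

/-- The two neighbours in row `j + 1` recombine by `krawtchouk_row` into one value with parameter `n
- j`. -/
lemma raise_right {i j : ℕ} (hij : i + j < n) :
    ((n : ℝ) - i - j) * (bivariate q n α β i (j + 1) / v i (j + 1))
      + i * (bivariate q n α β (i - 1) (j + 1) / v (i - 1) (j + 1)) =
    (j + 1) * (q : ℝ) ^ j * krawtchouk q (j + 1) ((n : ℝ) - β) α
      * krawtchouk q i ((n : ℝ) - j) β / (((q : ℝ) - 1) * v i j) := by
  have hq' : (2 : ℝ) ≤ q := by exact_mod_cast hq
  have hq1 : (0 : ℝ) < (q : ℝ) - 1 := by linarith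
  have h0 := hv.pos i j (by omega)
  have h1 := hv.pos i (j + 1) (by omega)
  have e1 : ((n : ℝ) - i - j) * (bivariate q n α β i (j + 1) / v i (j + 1)) =
      (j + 1) * (q : ℝ) ^ j * krawtchouk q (j + 1) ((n : ℝ) - β) α
      * krawtchouk q i ((n : ℝ) - (j + 1 : ℕ)) β / (((q : ℝ) - 1) * v i j) := by
    have h2 := hv.right i j (by omega)
    simp only [bivariate]
    rw [mul_div_assoc', div_eq_div_iff h1.ne' (mul_pos hq1 h0).ne']
    linear_combination (-(q : ℝ) ^ j * krawtchouk q (j + 1) ((n : ℝ) - β) α *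
      krawtchouk q i ((n : ℝ) - (j + 1 : ℕ)) β) * h2
  rw [e1]
  rcases i with _ | i
  · simp
  · have h2 := hv.pos i (j + 1) (by omega)
    have e2 : ((i + 1 : ℕ) : ℝ) * (bivariate q n α β (i + 1 - 1) (j + 1) /
        v (i + 1 - 1) (j + 1)) =
        (j + 1) * (q : ℝ) ^ j * krawtchouk q (j + 1) ((n : ℝ) - β) α
        * (((q : ℝ) - 1) * krawtchouk q i ((n : ℝ) - (j + 1 : ℕ)) β) /
          (((q : ℝ) - 1) * v (i + 1) j) := by
      have h3 := hv.diag (i := i) (j := j) (by omega)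
      rw [Nat.add_sub_cancel]
      simp only [bivariate]
      rw [mul_div_assoc', div_eq_div_iff h2.ne' (mul_pos hq1 h0).ne']
      push_cast
      linear_combination (-(q : ℝ) ^ j * krawtchouk q (j + 1) ((n : ℝ) - β) α *
        krawtchouk q i ((n : ℝ) - (j + 1)) β * ((q : ℝ) - 1)) * h3
    rw [e2, ← add_div, krawtchouk_row q n i j β]
    ring

/-- Steps within a row are governed by the recurrence at `β`; the combined steps to rows `j ± 1`
reduce to the recurrence in `j` at `α`. Strictness of `i + j < n` keeps the valencies of the upper
neighbours nonzero. -/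
lemma shapeOp_bivariate {i j : ℕ} (hij : i + j < n) :
    shapeOp q n (fun i j => bivariate q n α β i j / v i j) i j =
      (2 * n - (α + 2 * β)) * (bivariate q n α β i j / v i j) := by
  have hq' : (2 : ℝ) ≤ q := by exact_mod_cast hq
  have hq1 : (0 : ℝ) < (q : ℝ) - 1 := by linarith
  have h0 := hv.pos i j (by omega)
  have h1 := row_recurrence hv α β hij
  have h2 := raise_right hq hv α β hij
  have h3 : ((q : ℝ) - 1) * q * (((n : ℝ) - i - j) * (bivariate q n α β i (j + 1) / v i (j + 1))
      + i * (bivariate q n α β (i - 1) (j + 1) / v (i - 1) (j + 1)))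
      + j * (bivariate q n α β i (j - 1) / v i (j - 1)
        + ((q : ℝ) - 1) * (bivariate q n α β (i + 1) (j - 1) / v (i + 1) (j - 1))) =
      q * (((q : ℝ) - 1) * (n - β) - q * α - ((q : ℝ) - 2) * j) *
        (bivariate q n α β i j / v i j) := by
    rw [h2]
    rcases j with _ | j
    · simp [bivariate, krawtchouk_one]
      field_simp
    · have h4 := lower_right hv α β hij
      rw [Nat.add_sub_cancel]
      push_cast at h4 ⊢
      rw [h4]
      have h5 := krawtchouk_add_two q j ((n : ℝ) - β) α
      simp only [bivariate]
      field_simp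
      push_cast
      linear_combination krawtchouk q i ((n : ℝ) - (j + 1)) β * h5
  simp only [shapeOp]
  clear h2
  generalize bivariate q n α β i j / v i j = x at h1 h3 ⊢
  generalize bivariate q n α β (i + 1) j / v (i + 1) j = x1 at h1 h3 ⊢
  generalize bivariate q n α β (i - 1) j / v (i - 1) j = x2 at h1 h3 ⊢
  generalize bivariate q n α β i (j + 1) / v i (j + 1) = x3 at h1 h3 ⊢
  generalize bivariate q n α β (i - 1) (j + 1) / v (i - 1) (j + 1) = x4 at h1 h3 ⊢
  generalize bivariate q n α β i (j - 1) / v i (j - 1) = x5 at h1 h3 ⊢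
  generalize bivariate q n α β (i + 1) (j - 1) / v (i + 1) (j - 1) = x6 at h1 h3 ⊢
  field_simp
  linear_combination (1 + (q : ℝ)) * h1 + h3

end Eigen

/-! ### The region of positivity and its row sums. -/

section Region

variable {q n s₁ s₂ : ℕ} {β : ℝ}

lemma Region.pos {i j : ℕ} (h : Region q n s₂ β i j) : 0 < krawtchouk q i ((n : ℝ) - j) β :=
  h.2.2 i le_rfl

lemma region_zero {j : ℕ} (hj : j ≤ s₂) (hn : s₂ ≤ n) : Region q n s₂ β 0 j :=
  ⟨hj, by omega, fun i hi => by obtain rfl : i = 0 := by omega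
                                simp⟩

lemma Region.pred_left {i j : ℕ} (h : Region q n s₂ β i j) : Region q n s₂ β (i - 1) j :=
  ⟨h.1, by have := h.2.1; omega, fun i' hi' => h.2.2 i' (by omega)⟩

lemma Region.pred_right (hq : 2 ≤ q) {i j : ℕ} (h : Region q n s₂ β i (j + 1)) :
    Region q n s₂ β i j := by
  have hq' : (2 : ℝ) ≤ q := by exact_mod_cast hq
  refine ⟨by have := h.1; omega, by have := h.2.1; omega, fun i' hi' => ?_⟩
  rcases i' with _ | i'
  · simp
  · rw [krawtchouk_row]
    exact add_pos (h.2.2 _ hi') (mul_pos (by linarith) (h.2.2 _ (by omega)))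

lemma Region.nonpos_of_not {i j : ℕ} (h : Region q n s₂ β i j) (hij : i + 1 + j ≤ n)
    (h' : ¬ Region q n s₂ β (i + 1) j) : krawtchouk q (i + 1) ((n : ℝ) - j) β ≤ 0 := by
  by_contra hc
  refine h' ⟨h.1, hij, fun i' hi' => ?_⟩
  rcases Nat.lt_or_ge i' (i + 1) with hlt | hge
  · exact h.2.2 i' (by omega)
  · obtain rfl : i' = i + 1 := by omega
    exact not_le.1 hc

/-- A sign change in the index persists, shifted by at most one, when the parameter grows by
one. -/
lemma krawtchouk_sign_step (hq : 2 ≤ q) {N : ℝ} {i : ℕ} (hi : (i : ℝ) ≤ N) (hβ : β ≤ N + 1)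
    (h1 : krawtchouk q (i + 1) N β ≤ 0) (h2 : 0 < krawtchouk q (i + 1) (N + 1) β) :
    krawtchouk q (i + 2) (N + 1) β ≤ 0 := by
  have hq' : (2 : ℝ) ≤ q := by exact_mod_cast hq
  rw [krawtchouk_succ_add_one] at h2 ⊢
  have h := krawtchouk_add_two q i N β
  have e1 : 0 ≤ (N - i) * (krawtchouk q (i + 1) N β + ((q : ℝ) - 1) * krawtchouk q i N β) :=
    mul_nonneg (by linarith) h2.le
  have e2 : q * (N + 1 - β) * krawtchouk q (i + 1) N β ≤ 0 :=
    mul_nonpos_of_nonneg_of_nonpos (mul_nonneg (by linarith) (by linarith)) h1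
  have e3 : ((i : ℝ) + 2) * (krawtchouk q (i + 2) N β +
      ((q : ℝ) - 1) * krawtchouk q (i + 1) N β) ≤ 0 := by
    linarith
  by_contra hc
  exact e3.not_gt (mul_pos (by positivity) (not_le.1 hc))

/-- Otherwise a nonpositive value at some index `m + 1 ≤ i` in row `j + 1` would, by
`krawtchouk_sign_step`, give one at index `m + 2 ≤ i + 1` in row `j`. -/
lemma Region.shift (hq : 2 ≤ q) (hβ : β ≤ (n : ℝ) - s₂) {i j : ℕ} (h : Region q n s₂ β (i + 1) j)
    (hj : j < s₂) : Region q n s₂ β i (j + 1) := by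
  refine ⟨hj, by have := h.2.1; omega, fun i' => ?_⟩
  induction i' with
  | zero => simp
  | succ m ih =>
    intro hm
    by_contra hc
    have hN : (n : ℝ) - (j + 1 : ℕ) + 1 = (n : ℝ) - j := by push_cast; ring
    have hjs : (j : ℝ) + 1 ≤ s₂ := by exact_mod_cast hj
    have hmn : (m : ℝ) + (j + 1) ≤ n := by
      have := h.2.1
      exact_mod_cast (by omega : m + (j + 1) ≤ n)
    have := krawtchouk_sign_step hq (N := (n : ℝ) - (j + 1 : ℕ)) (i := m) (β := β)
      (by push_cast; linarith) (by push_cast; linarith) (not_lt.1 hc)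
      (by rw [hN]; exact h.2.2 _ (by omega))
    rw [hN] at this
    exact this.not_gt (h.2.2 _ (by omega))

/-- `Region.shift` moves a point along its antidiagonal towards row `s₂`, where the root condition
on `β` stops the region before `s₁`. -/
lemma Region.add_lt (hq : 2 ≤ q) (hβ : β ≤ (n : ℝ) - s₂)
    (hroot : krawtchouk q s₁ ((n : ℝ) - s₂) β = 0) {i j : ℕ}
    (h : Region q n s₂ β i j) : i + j < s₁ + s₂ := by
  obtain ⟨m, hm⟩ := Nat.exists_eq_add_of_le h.1
  induction m generalizing i j with
  | zero =>
    obtain rfl : s₂ = j := by omega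
    by_contra hc
    exact (h.2.2 s₁ (by omega)).ne' hroot
  | succ m ih =>
    rcases i with _ | i
    · have : s₁ ≠ 0 := by
        rintro rfl
        simp at hroot
      omega
    · have := ih (h.shift hq hβ (by omega)) (by omega)
      omega

lemma region_last_iff (hn : s₁ + s₂ ≤ n) (hroot : krawtchouk q s₁ ((n : ℝ) - s₂) β = 0)
    (hpos : ∀ i < s₁, 0 < krawtchouk q i ((n : ℝ) - s₂) β) {i : ℕ} :
    Region q n s₂ β i s₂ ↔ i < s₁ := by
  refine ⟨fun h => ?_, fun h => ⟨le_rfl, by omega, fun i' hi' => hpos i' (by omega)⟩⟩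
  by_contra hc
  exact (h.2.2 s₁ (by omega)).ne' hroot

open Classical in
/-- The sum of the values at `β` along a row of the region. -/
noncomputable def rowSum (q n s₂ : ℕ) (β : ℝ) (j : ℕ) : ℝ :=
  ∑ i ∈ Finset.range (n + 1),
    if Region q n s₂ β i j then krawtchouk q i ((n : ℝ) - j) β else 0

-- Each value in row `j` splits by `krawtchouk_row` into values of row `j + 1` with weights `1` and
-- `q - 1`, of total `q`. By `Region.shift` the second value lies in the region; the first either
-- does too or is nonpositive and can be dropped.
open Classical in
lemma rowSum_le (hq : 2 ≤ q) (hn : s₁ + s₂ ≤ n) (hβ : β ≤ (n : ℝ) - s₂)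
    (hroot : krawtchouk q s₁ ((n : ℝ) - s₂) β = 0) {j : ℕ} (hj : j < s₂) :
    rowSum q n s₂ β j ≤ q * rowSum q n s₂ β (j + 1) := by
  have hq' : (2 : ℝ) ≤ q := by exact_mod_cast hq
  have hnn : ∀ i, 0 ≤ if Region q n s₂ β i (j + 1) then
      krawtchouk q i ((n : ℝ) - (j + 1 : ℕ)) β else 0 := by
    intro i
    split_ifs with h
    · exact h.pos.le
    · exact le_rfl
  have hle : ∀ i, (if Region q n s₂ β (i + 1) j then krawtchouk q (i + 1) ((n : ℝ) - j) β else 0) ≤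
      (if Region q n s₂ β (i + 1) (j + 1) then
        krawtchouk q (i + 1) ((n : ℝ) - (j + 1 : ℕ)) β else 0) +
      ((q : ℝ) - 1) * (if Region q n s₂ β i (j + 1) then
        krawtchouk q i ((n : ℝ) - (j + 1 : ℕ)) β else 0) := by
    intro i
    by_cases h : Region q n s₂ β (i + 1) j
    · have h2 := h.shift hq hβ hj
      rw [if_pos h, if_pos h2, krawtchouk_row]
      split_ifs with h3
      · exact le_rfl
      · have h4 := h.add_lt hq hβ hroot
        have := h2.nonpos_of_not (by omega) h3
        linarith
    · rw [if_neg h]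
      exact add_nonneg (hnn _) (mul_nonneg (by linarith) (hnn _))
  have hS : ∑ i ∈ Finset.range n, (if Region q n s₂ β i (j + 1) then
      krawtchouk q i ((n : ℝ) - (j + 1 : ℕ)) β else 0) ≤ rowSum q n s₂ β (j + 1) := by
    rw [rowSum, Finset.sum_range_succ]
    exact le_add_of_nonneg_right (hnn n)
  have hS' : ∑ i ∈ Finset.range n, (if Region q n s₂ β (i + 1) (j + 1) then
      krawtchouk q (i + 1) ((n : ℝ) - (j + 1 : ℕ)) β else 0) + 1 = rowSum q n s₂ β (j + 1) := by
    rw [rowSum, Finset.sum_range_succ', if_pos (region_zero hj (by omega)), krawtchouk_zero]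
  have h0 : rowSum q n s₂ β j = ∑ i ∈ Finset.range n,
      (if Region q n s₂ β (i + 1) j then krawtchouk q (i + 1) ((n : ℝ) - j) β else 0) + 1 := by
    rw [rowSum, Finset.sum_range_succ', if_pos (region_zero hj.le (by omega)), krawtchouk_zero]
  have h1 := Finset.sum_le_sum fun i (_ : i ∈ Finset.range n) => hle i
  rw [Finset.sum_add_distrib, ← Finset.mul_sum] at h1
  have h2 := mul_le_mul_of_nonneg_left hS (by linarith : (0 : ℝ) ≤ (q : ℝ) - 1)
  rw [h0]
  linarith

lemma rowSum_le_last (hq : 2 ≤ q) (hn : s₁ + s₂ ≤ n) (hβ : β ≤ (n : ℝ) - s₂)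
    (hroot : krawtchouk q s₁ ((n : ℝ) - s₂) β = 0) {j : ℕ} (hj : j ≤ s₂) :
    (q : ℝ) ^ j * rowSum q n s₂ β j ≤ (q : ℝ) ^ s₂ * rowSum q n s₂ β s₂ := by
  induction hj using Nat.decreasingInduction with
  | self => exact le_rfl
  | of_succ j hj ih =>
    refine le_trans ?_ ih
    rw [pow_succ, mul_assoc]
    exact mul_le_mul_of_nonneg_left (rowSum_le hq hn hβ hroot hj) (by positivity)

lemma rowSum_last (hn : s₁ + s₂ ≤ n) (hroot : krawtchouk q s₁ ((n : ℝ) - s₂) β = 0)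
    (hpos : ∀ i < s₁, 0 < krawtchouk q i ((n : ℝ) - s₂) β) :
    rowSum q n s₂ β s₂ = ∑ i ∈ Finset.range s₁, krawtchouk q i ((n : ℝ) - s₂) β := by
  classical
  simp only [rowSum, region_last_iff hn hroot hpos]
  rw [← Finset.sum_filter]
  refine Finset.sum_congr ?_ fun _ _ => rfl
  ext i
  simp only [Finset.mem_filter, Finset.mem_range]
  omega

end Region


/-! ### The cut-off eigenfunction: nonnegative defect and total mass. -/

open Classical in
/-- The normalized bivariate Krawtchouk values at `(α, β)`, cut off outside the region. -/
noncomputable def cutoff (q n s₂ : ℕ) (v : ℕ → ℕ → ℝ) (α β : ℝ) (i j : ℕ) : ℝ :=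
  if Region q n s₂ β i j then bivariate q n α β i j / v i j else 0

/-- The properties of the point `(α, β)` on which the bounds rest. -/
structure PointData (q n s₁ s₂ : ℕ) (α β : ℝ) : Prop where
  two_le : 2 ≤ q
  one_le : 1 ≤ s₁
  add_le : s₁ + s₂ ≤ n
  alpha_pos : 0 < α
  beta_pos : 0 < β
  beta_lt : β < (n : ℝ) - s₂
  root : krawtchouk q s₁ ((n : ℝ) - s₂) β = 0
  left_pos : ∀ i < s₁, 0 < krawtchouk q i ((n : ℝ) - s₂) β
  right_pos : ∀ j ≤ s₂, 0 < krawtchouk q j ((n : ℝ) - β) α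
  balance : ((s₂ : ℝ) + 1) * krawtchouk q (s₂ + 1) ((n : ℝ) - β) α =
    -(((q : ℝ) - 1) * ((n : ℝ) - β - s₂) * krawtchouk q s₂ ((n : ℝ) - β) α)

section

variable {q n s₁ s₂ : ℕ} {α β : ℝ} {v : ℕ → ℕ → ℝ}

lemma PointData.one_lt (H : PointData q n s₁ s₂ α β) : (1 : ℝ) < q := by
  exact_mod_cast H.two_le

lemma cutoff_of_region {i j : ℕ} (h : Region q n s₂ β i j) :
    cutoff q n s₂ v α β i j = bivariate q n α β i j / v i j := if_pos h

lemma cutoff_of_not {i j : ℕ} (h : ¬ Region q n s₂ β i j) : cutoff q n s₂ v α β i j = 0 :=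
  if_neg h

variable (H : PointData q n s₁ s₂ α β) (hv : IsValency q n v)

include H

lemma PointData.bivariate_nonpos {i j : ℕ} (hj : j ≤ s₂)
    (h : krawtchouk q i ((n : ℝ) - j) β ≤ 0) : bivariate q n α β i j ≤ 0 :=
  mul_nonpos_of_nonneg_of_nonpos (mul_nonneg (by positivity) (H.right_pos j hj).le) h

lemma PointData.region_shape : Region q n s₂ β (s₁ - 1) s₂ :=
  (region_last_iff H.add_le H.root H.left_pos).2 (by have := H.one_le; omega)

include hv

lemma PointData.cutoff_nonneg (i j : ℕ) : 0 ≤ cutoff q n s₂ v α β i j := by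
  by_cases h : Region q n s₂ β i j
  · rw [cutoff_of_region h]
    exact div_nonneg (mul_nonneg (mul_nonneg (by positivity) (H.right_pos j h.1).le) h.pos.le)
      (hv.pos i j h.2.1).le
  · rw [cutoff_of_not h]

omit H in
lemma IsValency.div_le_cutoff {i j : ℕ} (hij : i + j ≤ n)
    (h : ¬ Region q n s₂ β i j → bivariate q n α β i j ≤ 0) :
    0 ≤ cutoff q n s₂ v α β i j - bivariate q n α β i j / v i j := by
  by_cases hR : Region q n s₂ β i j
  · rw [cutoff_of_region hR, sub_self]
  · rw [cutoff_of_not hR, zero_sub]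
    exact neg_nonneg.2 (div_nonpos_of_nonpos_of_nonneg (h hR) (hv.pos i j hij).le)

/-- On the region the defect of the cut-off eigenfunction is at least the contribution of the
neighbours in the next column. -/
lemma PointData.defect_le {i j : ℕ} (h : Region q n s₂ β i j) :
    (q : ℝ)⁻¹ * ((q : ℝ) - 1) *
      (((n : ℝ) - i - j) *
        (cutoff q n s₂ v α β i (j + 1) - bivariate q n α β i (j + 1) / v i (j + 1))
      + i * (cutoff q n s₂ v α β (i - 1) (j + 1)
        - bivariate q n α β (i - 1) (j + 1) / v (i - 1) (j + 1))) ≤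
    shapeOp q n (cutoff q n s₂ v α β) i j
      - (2 * n - (α + 2 * β)) * cutoff q n s₂ v α β i j := by
  have hq := H.one_lt
  have hlt : i + j < n := (h.add_lt H.two_le H.beta_lt.le H.root).trans_le H.add_le
  have hk : (0 : ℝ) ≤ (n : ℝ) - i - j := by
    have : (i : ℝ) + j ≤ n := by exact_mod_cast hlt.le
    linarith
  have e0 := cutoff_of_region (α := α) (v := v) h
  have e1 := cutoff_of_region (α := α) (v := v) h.pred_left
  have e2 : (j : ℝ) * cutoff q n s₂ v α β i (j - 1) =
      j * (bivariate q n α β i (j - 1) / v i (j - 1)) := by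
    rcases j with _ | j
    · simp
    · rw [Nat.add_sub_cancel, cutoff_of_region (h.pred_right H.two_le)]
  have i1 := hv.div_le_cutoff (i := i + 1) (j := j) (by omega)
    fun hR => H.bivariate_nonpos h.1 (h.nonpos_of_not (by omega) hR)
  have i2 : 0 ≤ (j : ℝ) * (cutoff q n s₂ v α β (i + 1) (j - 1)
      - bivariate q n α β (i + 1) (j - 1) / v (i + 1) (j - 1)) := by
    rcases j with _ | j
    · simp
    · have h' := h.pred_right H.two_le
      exact mul_nonneg (by positivity) (hv.div_le_cutoff (i := i + 1) (j := j) (by omega)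
        fun hR => H.bivariate_nonpos h'.1 (h'.nonpos_of_not (by omega) hR))
  have e3 := shapeOp_bivariate H.two_le hv α β hlt
  rw [e0, ← e3]
  simp only [shapeOp]
  rw [e0, e1]
  have j1 : 0 ≤ ((n : ℝ) - i - j) * (((q : ℝ)⁻¹ ^ 2 + (q : ℝ)⁻¹) * (((q : ℝ) - 1) *
      (cutoff q n s₂ v α β (i + 1) j - bivariate q n α β (i + 1) j / v (i + 1) j))) :=
    mul_nonneg hk (mul_nonneg (by positivity) (mul_nonneg (by linarith) i1))
  have j2 : 0 ≤ (q : ℝ)⁻¹ ^ 2 * (((q : ℝ) - 1) * ((j : ℝ) * (cutoff q n s₂ v α β (i + 1) (j - 1)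
      - bivariate q n α β (i + 1) (j - 1) / v (i + 1) (j - 1)))) :=
    mul_nonneg (by positivity) (mul_nonneg (by linarith) i2)
  rw [← sub_nonneg]
  refine (add_nonneg j1 j2).trans (le_of_eq ?_)
  linear_combination -(q : ℝ)⁻¹ ^ 2 * e2

/-- In row `s₂` the whole next row is cut off. `raise_right` expresses the loss through `k_{s₂+1}`
at `α`, and the balance equation turns this into a positive multiple of `k_{s₂}`. -/
lemma PointData.defect_last {i : ℕ} (hi : i < s₁) :
    (q : ℝ)⁻¹ * ((q : ℝ) - 1) * ((n : ℝ) - β - s₂) * (bivariate q n α β i s₂ / v i s₂) ≤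
    shapeOp q n (cutoff q n s₂ v α β) i s₂
      - (2 * n - (α + 2 * β)) * cutoff q n s₂ v α β i s₂ := by
  have hq := H.one_lt
  have hR := (region_last_iff H.add_le H.root H.left_pos).2 hi
  refine le_trans (le_of_eq ?_) (H.defect_le hv hR)
  have hn : i + s₂ < n := by have := H.add_le; omega
  have h0 := hv.pos i s₂ hn.le
  have hnot : ∀ i, ¬ Region q n s₂ β i (s₂ + 1) := fun i h => by have := h.1; omega
  rw [cutoff_of_not (hnot _), cutoff_of_not (hnot _), zero_sub, zero_sub, mul_neg, mul_neg,
    ← neg_add, raise_right H.two_le hv α β hn]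
  have hq1 : (q : ℝ) - 1 ≠ 0 := by linarith
  simp only [bivariate]
  field_simp
  linear_combination krawtchouk q i ((n : ℝ) - s₂) β * H.balance

/-- Outside the region the cut-off vanishes and `shapeOp` has nonnegative coefficients. In the
region below row `s₂`, of the two neighbours in row `j + 1` the one at `i - 1` is retained by
`Region.shift`, while the one at `i` is retained or has a nonpositive value. -/
lemma PointData.defect_nonneg {i j : ℕ} (hij : i + j ≤ n) :
    0 ≤ shapeOp q n (cutoff q n s₂ v α β) i j
      - (2 * n - (α + 2 * β)) * cutoff q n s₂ v α β i j := by
  have hq := H.one_lt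
  have hq1 : (0 : ℝ) ≤ (q : ℝ) - 1 := by linarith
  have hk : (0 : ℝ) ≤ (n : ℝ) - i - j := by
    have : (i : ℝ) + j ≤ n := by exact_mod_cast hij
    linarith
  have hc := H.cutoff_nonneg hv
  by_cases h : Region q n s₂ β i j
  · rcases h.1.eq_or_lt with rfl | hj
    · have hi := (region_last_iff H.add_le H.root H.left_pos).1 h
      refine le_trans ?_ (H.defect_last hv hi)
      rw [← cutoff_of_region h]
      have := hc i j
      have := H.beta_lt
      have : 0 ≤ (n : ℝ) - β - j := by linarith
      positivity
    · refine le_trans ?_ (H.defect_le hv h)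
      have hlt := h.add_lt H.two_le H.beta_lt.le H.root
      have hn := H.add_le
      refine mul_nonneg (by positivity) (add_nonneg (mul_nonneg hk ?_) ?_)
      · refine hv.div_le_cutoff (by omega) fun hR => H.bivariate_nonpos hj ?_
        rcases i with _ | i
        · exact absurd (region_zero hj (by omega)) hR
        · exact (h.shift H.two_le H.beta_lt.le hj).nonpos_of_not (by omega) hR
      · rcases i with _ | i
        · simp
        · rw [Nat.add_sub_cancel, cutoff_of_region (h.shift H.two_le H.beta_lt.le hj), sub_self,
            mul_zero]
  · rw [cutoff_of_not h, mul_zero, sub_zero, shapeOp]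
    have h1 := hc i j
    have h2 := hc (i + 1) j
    have h3 := hc i (j + 1)
    have h4 := hc (i - 1) j
    have h5 := hc (i - 1) (j + 1)
    have h6 := hc i (j - 1)
    have h7 := hc (i + 1) (j - 1)
    positivity

-- The valencies cancel, leaving row sums weighted by `k_j` at `α`. Every `q ^ j * rowSum` is at
-- most its value at `s₂`, so the bound factors into two partial sums. `sum_krawtchouk` evaluates
-- both: balance doubles the one in `α`, and the root condition removes the last term of the one in
-- `β`.
open Classical in
lemma PointData.sum_cutoff_le :
    ∑ j ∈ Finset.range (n + 1), ∑ i ∈ Finset.range (n + 1), v i j * cutoff q n s₂ v α β i j ≤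
      2 * ((q : ℝ) - 1) ^ 2 * ((n : ℝ) - s₂ - s₁ + 1) * ((n : ℝ) - β - s₂) / (q ^ 2 * α * β)
        * bivariate q n α β (s₁ - 1) s₂ := by
  have hq := H.one_lt
  have hn := H.add_le
  have hα := H.alpha_pos
  have hβ := H.beta_pos
  have e1 : ∀ j, ∑ i ∈ Finset.range (n + 1), v i j * cutoff q n s₂ v α β i j =
      krawtchouk q j ((n : ℝ) - β) α * ((q : ℝ) ^ j * rowSum q n s₂ β j) := by
    intro j
    rw [rowSum, Finset.mul_sum, Finset.mul_sum]
    refine Finset.sum_congr rfl fun i _ => ?_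
    by_cases h : Region q n s₂ β i j
    · rw [cutoff_of_region h, if_pos h, mul_div_cancel₀ _ (hv.pos i j h.2.1).ne', bivariate]
      ring
    · rw [cutoff_of_not h, if_neg h]
      simp
  have e2 : ∑ j ∈ Finset.range (n + 1), ∑ i ∈ Finset.range (n + 1),
      v i j * cutoff q n s₂ v α β i j =
      ∑ j ∈ Finset.range (s₂ + 1), krawtchouk q j ((n : ℝ) - β) α *
        ((q : ℝ) ^ j * rowSum q n s₂ β j) := by
    simp only [e1]
    symm
    refine Finset.sum_subset (Finset.range_subset_range.2 (by omega)) fun j _ hj => ?_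
    have : rowSum q n s₂ β j = 0 := by
      refine Finset.sum_eq_zero fun i _ => if_neg fun h => ?_
      have := h.1
      simp at hj
      omega
    rw [this]
    simp
  rw [e2]
  have i1 : ∑ j ∈ Finset.range (s₂ + 1), krawtchouk q j ((n : ℝ) - β) α *
      ((q : ℝ) ^ j * rowSum q n s₂ β j) ≤
      (∑ j ∈ Finset.range (s₂ + 1), krawtchouk q j ((n : ℝ) - β) α) *
        ((q : ℝ) ^ s₂ * rowSum q n s₂ β s₂) := by
    rw [Finset.sum_mul]
    refine Finset.sum_le_sum fun j hj => ?_
    have hj' : j ≤ s₂ := Nat.lt_succ_iff.1 (Finset.mem_range.1 hj)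
    exact mul_le_mul_of_nonneg_left (rowSum_le_last H.two_le hn H.beta_lt.le H.root hj')
      (H.right_pos j hj').le
  refine i1.trans (le_of_eq ?_)
  have e3 : ∑ j ∈ Finset.range (s₂ + 1), krawtchouk q j ((n : ℝ) - β) α =
      2 * ((q : ℝ) - 1) * ((n : ℝ) - β - s₂) * krawtchouk q s₂ ((n : ℝ) - β) α / (q * α) := by
    rw [eq_div_iff (by positivity)]
    linear_combination sum_krawtchouk q s₂ ((n : ℝ) - β) α - H.balance
  have e4 : rowSum q n s₂ β s₂ = ((q : ℝ) - 1) * ((n : ℝ) - s₂ - s₁ + 1) *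
      krawtchouk q (s₁ - 1) ((n : ℝ) - s₂) β / (q * β) := by
    rw [rowSum_last hn H.root H.left_pos, eq_div_iff (by positivity)]
    obtain ⟨m, rfl⟩ := Nat.exists_eq_add_of_le' H.one_le
    have h1 := sum_krawtchouk q m ((n : ℝ) - s₂) β
    rw [H.root] at h1
    rw [Nat.add_sub_cancel]
    push_cast
    linear_combination h1
  rw [e3, e4, bivariate]
  field_simp

end


/-! ### Characters and Fourier transform. -/

open ComplexConjugate

section Characters

variable {q n : ℕ} [NeZero q]

/-- The characters of the space, indexed so that the coordinates of each block are paired in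
reversed order. -/
noncomputable def chi (w : Space q n 2) : AddChar (Space q n 2) ℂ where
  toFun z := ZMod.stdAddChar (∑ i, (w i 0 * z i 1 + w i 1 * z i 0))
  map_zero_eq_one' := by simp
  map_add_eq_mul' x y := by
    rw [← AddChar.map_add_eq_mul, ← Finset.sum_add_distrib]
    congr 1
    refine Finset.sum_congr rfl fun i _ => ?_
    simp only [Pi.add_apply]
    ring

lemma chi_apply (w z : Space q n 2) :
    chi w z = ZMod.stdAddChar (∑ i, (w i 0 * z i 1 + w i 1 * z i 0)) := rfl

lemma chi_comm (w z : Space q n 2) : chi w z = chi z w := by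
  simp only [chi_apply]
  congr 1
  refine Finset.sum_congr rfl fun i _ => ?_
  ring

lemma chi_add_left (w w' z : Space q n 2) : chi (w + w') z = chi w z * chi w' z := by
  rw [chi_comm, AddChar.map_add_eq_mul, chi_comm z, chi_comm z]

lemma chi_neg_left (w z : Space q n 2) : chi (-w) z = conj (chi w z) := by
  rw [chi_comm, AddChar.map_neg_eq_conj, chi_comm z]

lemma chi_sub_left (w w' z : Space q n 2) : chi (w - w') z = chi w z * conj (chi w' z) := by
  rw [sub_eq_add_neg, chi_add_left, chi_neg_left]

lemma chi_sub_right (w z z' : Space q n 2) : chi w (z - z') = chi w z * conj (chi w z') := by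
  rw [sub_eq_add_neg, AddChar.map_add_eq_mul, AddChar.map_neg_eq_conj]

@[simp] lemma chi_zero_left (z : Space q n 2) : chi 0 z = 1 := by simp [chi_apply]

lemma chi_eq_zero_iff (w : Space q n 2) : chi w = 0 ↔ w = 0 := by
  refine ⟨fun h => ?_, fun h => ?_⟩
  · have key : ∀ z : Space q n 2, ∑ i, (w i 0 * z i 1 + w i 1 * z i 0) = 0 := by
      intro z
      refine ZMod.injective_stdAddChar ?_
      rw [← chi_apply, h]
      simp
    funext i
    have h1 := key (Pi.single i ![0, 1])
    have h2 := key (Pi.single i ![1, 0])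
    rw [Finset.sum_eq_single i (fun j _ hj => by simp [Pi.single_eq_of_ne hj])
      (fun hi => absurd (Finset.mem_univ i) hi)] at h1 h2
    simp at h1 h2
    funext k
    fin_cases k
    · exact h1
    · exact h2
  · subst h
    ext z
    simp

lemma card_space : Fintype.card (Space q n 2) = q ^ (n * 2) := by
  simp [ZMod.card, pow_mul, pow_right_comm]

open Classical in
lemma sum_chi (w : Space q n 2) :
    ∑ z, chi w z = if w = 0 then (q : ℂ) ^ (n * 2) else 0 := by
  rw [AddChar.sum_eq_ite, card_space]
  simp [chi_eq_zero_iff]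

/-- The function with Fourier coefficients `f`. -/
noncomputable def fourier (f : Space q n 2 → ℝ) (z : Space q n 2) : ℂ := ∑ w, (f w : ℂ) * chi w z

lemma fourier_zero (f : Space q n 2 → ℝ) : fourier f 0 = ((∑ w, f w : ℝ) : ℂ) := by
  simp [fourier]

lemma fourier_conj {f : Space q n 2 → ℝ} (hf : ∀ w, f (-w) = f w) (z : Space q n 2) :
    conj (fourier f z) = fourier f z := by
  rw [fourier, map_sum, ← Equiv.sum_comp (Equiv.neg _)]
  refine Finset.sum_congr rfl fun w _ => ?_
  simp only [Equiv.neg_apply, map_mul, Complex.conj_ofReal, hf, chi_neg_left, Complex.conj_conj]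

lemma fourier_conv (f g : Space q n 2 → ℝ) (z : Space q n 2) :
    fourier (fun w => ∑ x, f x * g (w - x)) z = fourier f z * fourier g z := by
  simp only [fourier, Complex.ofReal_sum, Finset.sum_mul]
  rw [Finset.sum_comm]
  refine Finset.sum_congr rfl fun x _ => ?_
  rw [Finset.mul_sum, ← Equiv.sum_comp (Equiv.addRight x)]
  refine Finset.sum_congr rfl fun w _ => ?_
  simp only [Equiv.coe_addRight, add_sub_cancel_right, chi_add_left]
  push_cast
  ring

lemma fourier_translate (f : Space q n 2 → ℝ) (u z : Space q n 2) :
    fourier (fun w => f (w + u)) z = conj (chi u z) * fourier f z := by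
  rw [fourier, fourier, ← Equiv.sum_comp (Equiv.subRight u), Finset.mul_sum]
  refine Finset.sum_congr rfl fun w _ => ?_
  simp only [Equiv.subRight_apply, sub_add_cancel, chi_sub_left]
  ring

omit [NeZero q] in
lemma sum_mul_normSq {ι κ : Type*} [Fintype κ] (C : Finset ι) (g : κ → ℂ) (s : κ → ι → ℂ) :
    ∑ x ∈ C, ∑ y ∈ C, ∑ w, g w * (s w x * conj (s w y)) =
      ∑ w, g w * Complex.normSq (∑ x ∈ C, s w x) := by
  have h : ∀ x, ∑ y ∈ C, ∑ w, g w * (s w x * conj (s w y)) =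
      ∑ w, ∑ y ∈ C, g w * (s w x * conj (s w y)) := fun x => Finset.sum_comm
  simp only [h]
  rw [Finset.sum_comm]
  refine Finset.sum_congr rfl fun w _ => ?_
  rw [← Complex.mul_conj, map_sum, Finset.sum_mul_sum, Finset.mul_sum]
  simp only [Finset.mul_sum]

lemma sum_fourier_mul_chi (f : Space q n 2 → ℝ) (u : Space q n 2) :
    ∑ z, fourier f z * chi z u = (q : ℂ) ^ (n * 2) * f (-u) := by
  classical
  simp only [fourier, Finset.sum_mul]
  rw [Finset.sum_comm]
  have h : ∀ w, ∑ z, (f w : ℂ) * chi w z * chi z u =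
      if w = -u then (q : ℂ) ^ (n * 2) * f (-u) else 0 := by
    intro w
    simp only [mul_assoc, chi_comm _ u, ← chi_add_left, ← Finset.mul_sum, sum_chi]
    by_cases hw : w = -u
    · rw [if_pos hw, if_pos (eq_neg_iff_add_eq_zero.1 hw), hw, mul_comm]
    · rw [if_neg hw, if_neg fun h => hw (eq_neg_iff_add_eq_zero.2 h), mul_zero]
  simp only [h, Finset.sum_ite_eq', Finset.mem_univ, if_true]

/-! ### Linear programming bounds for codes and arrays. -/

/-- The linear programming bound for codes. -/
lemma code_bound {f F : Space q n 2 → ℝ} (hF : ∀ z, (F z : ℂ) = fourier f z) (hf : ∀ w, 0 ≤ f w)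
    {d : ℕ} (hFd : ∀ z, d ≤ weight z → F z ≤ 0) (hF0 : 0 ≤ F 0) {C : Finset (Space q n 2)} {M : ℕ}
    (hC : IsCode C M d) : f 0 * M ≤ F 0 := by
  obtain ⟨rfl, hd⟩ := hC
  rcases C.eq_empty_or_nonempty with rfl | hne
  · simpa using hF0
  have hpos : (0 : ℝ) < C.card := by exact_mod_cast hne.card_pos
  set S : Space q n 2 → ℂ := fun w => ∑ x ∈ C, chi w x with hS
  have e : ∑ x ∈ C, ∑ y ∈ C, F (x - y) = ∑ w, f w * Complex.normSq (S w) := by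
    have : ((∑ x ∈ C, ∑ y ∈ C, F (x - y) : ℝ) : ℂ) =
        ((∑ w, f w * Complex.normSq (S w) : ℝ) : ℂ) := by
      push_cast
      simp only [hF, fourier, chi_sub_right]
      exact sum_mul_normSq C _ _
    exact_mod_cast this
  have h1 : f 0 * (C.card : ℝ) ^ 2 ≤ ∑ w, f w * Complex.normSq (S w) := by
    have h2 : f 0 * Complex.normSq (S 0) ≤ ∑ w, f w * Complex.normSq (S w) :=
      Finset.single_le_sum (f := fun w => f w * Complex.normSq (S w))
        (fun w _ => mul_nonneg (hf w) (Complex.normSq_nonneg _)) (Finset.mem_univ 0)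
    simpa [hS, sq] using h2
  have h2 : ∑ x ∈ C, ∑ y ∈ C, F (x - y) ≤ C.card * F 0 := by
    rw [← nsmul_eq_mul]
    refine Finset.sum_le_card_nsmul _ _ _ fun x hx => ?_
    rw [← Finset.add_sum_erase C _ hx, sub_self]
    refine add_le_of_nonpos_right (Finset.sum_nonpos fun y hy => ?_)
    exact hFd _ (hd x hx y (Finset.mem_of_mem_erase hy) (Finset.ne_of_mem_erase hy).symm)
  refine le_of_mul_le_mul_left ?_ hpos
  linarith

/-- Double counting of pairs `(x, y)` with `x ∈ A` agreeing on `I`: each `y` is met `θ` times, while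
each `x` agrees with the same positive number `c` of vectors `y`. -/
lemma sum_eq_zero_of_uniform {A : Finset (Space q n 2)} {I : Finset (Fin n × Fin 2)} {θ : ℕ}
    (hθ : ∀ y : Space q n 2, (A.filter fun x => ∀ p ∈ I, x p.1 p.2 = y p.1 p.2).card = θ)
    {g : Space q n 2 → ℂ} (hg : ∀ x y : Space q n 2, (∀ p ∈ I, x p.1 p.2 = y p.1 p.2) → g x = g y)
    (h0 : ∑ y, g y = 0) : ∑ x ∈ A, g x = 0 := by
  have e1 : ∑ y : Space q n 2, ∑ x ∈ A, (if ∀ p ∈ I, x p.1 p.2 = y p.1 p.2 then g x else 0) = 0 := by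
    have : ∀ y : Space q n 2, ∑ x ∈ A, (if ∀ p ∈ I, x p.1 p.2 = y p.1 p.2 then g x else 0) = θ * g y := by
      intro y
      rw [← Finset.sum_filter, ← hθ y, ← nsmul_eq_mul]
      exact Finset.sum_eq_card_nsmul fun x hx => hg x y (Finset.mem_filter.1 hx).2
    simp only [this, ← Finset.mul_sum, h0, mul_zero]
  rw [Finset.sum_comm] at e1
  set c : ℕ := (Finset.univ.filter fun y : Space q n 2 => ∀ p ∈ I, y p.1 p.2 = 0).card with hc
  have hcpos : 0 < c := Finset.card_pos.2 ⟨0, by simp⟩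
  have e2 : ∀ x, ∑ y : Space q n 2, (if ∀ p ∈ I, x p.1 p.2 = y p.1 p.2 then g x else 0) =
      c * g x := by
    intro x
    rw [← Equiv.sum_comp (Equiv.addRight x), ← Finset.sum_filter, Finset.sum_const, nsmul_eq_mul,
      hc]
    simp
  simp only [e2, ← Finset.mul_sum] at e1
  exact (mul_eq_zero.1 e1).resolve_left (by exact_mod_cast hcpos.ne')

omit [NeZero q] in
lemma exists_leftAdjusted_insert {I : Finset (Fin n × Fin 2)} (hI : LeftAdjusted I)
    (hcard : I.card < n * 2) : ∃ p ∉ I, LeftAdjusted (insert p I) := by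
  by_cases h : ∃ i, (i, (0 : Fin 2)) ∉ I
  · obtain ⟨i, hi⟩ := h
    refine ⟨_, hi, fun i' j j' hj hmem => ?_⟩
    rw [Finset.mem_insert] at hmem ⊢
    rcases hmem with hmem | hmem
    · left
      obtain ⟨rfl, rfl⟩ := Prod.mk.inj hmem
      rw [Fin.le_zero_iff.1 hj]
    · exact Or.inr (hI i' j j' hj hmem)
  · push Not at h
    obtain ⟨p, hp⟩ : ∃ p, p ∉ I := by
      by_contra hc
      push Not at hc
      have : I = Finset.univ := Finset.eq_univ_of_forall hc
      subst this
      simp at hcard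
    refine ⟨p, hp, fun i j j' hj hmem => ?_⟩
    rw [Finset.mem_insert] at hmem ⊢
    rcases hmem with hmem | hmem
    · subst hmem
      rcases hj.eq_or_lt with rfl | hj
      · exact Or.inl rfl
      · right
        have : j' = 0 := by omega
        subst this
        exact h i
    · exact Or.inr (hI i j j' hj hmem)

omit [NeZero q] in
lemma exists_leftAdjusted_superset {I : Finset (Fin n × Fin 2)} (hI : LeftAdjusted I) {t : ℕ}
    (h1 : I.card ≤ t) (h2 : t ≤ n * 2) :
    ∃ J, I ⊆ J ∧ LeftAdjusted J ∧ J.card = t := by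
  induction t, h1 using Nat.le_induction with
  | base => exact ⟨I, subset_rfl, hI, rfl⟩
  | succ t ht ih =>
    obtain ⟨J, hIJ, hJ, hc⟩ := ih (by omega)
    obtain ⟨p, hp, hJp⟩ := exists_leftAdjusted_insert hJ (by omega)
    exact ⟨insert p J, hIJ.trans (Finset.subset_insert _ _), hJp,
      by rw [Finset.card_insert_of_notMem hp, hc]⟩

/-- The vector with the two coordinates of every block exchanged. -/
def swapBlocks (x : Space q n 2) : Space q n 2 := fun i => x i ∘ Fin.rev

/-- Swapping undoes the reversed pairing, so the character of `z` depends only on the coordinates in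
`leftHull z`, as the array property requires. -/
lemma chi_swapBlocks (x z : Space q n 2) :
    chi z (swapBlocks x) = ZMod.stdAddChar (∑ i, ∑ k, x i k * z i k) := by
  rw [chi_apply]
  congr 1
  refine Finset.sum_congr rfl fun i _ => ?_
  rw [Fin.sum_univ_two]
  simp [swapBlocks, Fin.rev]
  ring

omit [NeZero q] in
lemma swapBlocks_sub (x y : Space q n 2) : swapBlocks x - swapBlocks y = swapBlocks (x - y) := rfl

/-- The coordinates up to the rightmost nonzero one in each block. -/
def leftHull (z : Space q n 2) : Finset (Fin n × Fin 2) :=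
  Finset.univ.filter fun p => (p.2 : ℕ) < blockWeight (z p.1)

omit [NeZero q] in
lemma leftAdjusted_leftHull (z : Space q n 2) : LeftAdjusted (leftHull z) := by
  intro i j j' hj h
  simp only [leftHull, Finset.mem_filter, Finset.mem_univ, true_and] at h ⊢
  exact lt_of_le_of_lt hj h

omit [NeZero q] in
lemma eq_zero_of_notMem_leftHull {z : Space q n 2} {p : Fin n × Fin 2} (h : p ∉ leftHull z) :
    z p.1 p.2 = 0 := by
  by_contra hc
  refine h (Finset.mem_filter.2 ⟨Finset.mem_univ _, Nat.lt_of_succ_le ?_⟩)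
  exact Finset.le_sup (f := fun j : Fin 2 => (j : ℕ) + 1)
    (Finset.mem_filter.2 ⟨Finset.mem_univ p.2, hc⟩)

/-- The linear programming bound for ordered orthogonal arrays. -/
lemma ooa_bound {f F : Space q n 2 → ℝ} (hF : ∀ z, (F z : ℂ) = fourier f z) (hf : ∀ w, 0 ≤ f w)
    {t : ℕ} (hFd : ∀ z, t + 1 ≤ weight z → F z ≤ 0)
    (hhull : ∀ z : Space q n 2, (leftHull z).card = weight z) {A : Finset (Space q n 2)} {M : ℕ}
    (hA : IsOOA A t M) : (q : ℝ) ^ (n * 2) * f 0 ≤ F 0 * M := by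
  obtain ⟨rfl, ht, θ, hθ, hA⟩ := hA
  have hpos : (0 : ℝ) < A.card := by
    obtain ⟨J, -, hJ, hc⟩ := exists_leftAdjusted_superset (I := (∅ : Finset (Fin n × Fin 2)))
      (by intro i j j' _ h; simp at h) (Nat.zero_le t) ht
    have h := hA J hJ hc 0
    have : 0 < A.card := by
      rw [← h] at hθ
      exact hθ.trans_le (Finset.card_filter_le _ _)
    exact_mod_cast this
  set S : Space q n 2 → ℂ := fun z => ∑ x ∈ A, chi z (swapBlocks x) with hS
  -- The hull of `z` has `weight z ≤ t` elements and extends to a left-adjusted set of size `t`, on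
  -- which `A` is uniform; a nontrivial character then sums to zero over `A`.
  have hS0 : ∀ z, z ≠ 0 → weight z ≤ t → S z = 0 := by
    intro z hz hzt
    obtain ⟨J, hzJ, hJ, hc⟩ := exists_leftAdjusted_superset (leftAdjusted_leftHull z)
      ((hhull z).trans_le hzt) ht
    refine sum_eq_zero_of_uniform (hA J hJ hc) (fun x y hxy => ?_) ?_
    · rw [chi_swapBlocks, chi_swapBlocks]
      congr 1
      refine Finset.sum_congr rfl fun i _ => Finset.sum_congr rfl fun k _ => ?_
      by_cases hp : (i, k) ∈ J
      · rw [hxy _ hp]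
      · rw [eq_zero_of_notMem_leftHull (z := z) (p := (i, k)) fun h => hp (hzJ h)]
        simp
    · classical
      have e : ∑ y, chi z (swapBlocks y) = ∑ y, chi z y :=
        Equiv.sum_comp (Equiv.piCongrRight fun _ : Fin n =>
          Equiv.arrowCongr Fin.revPerm (Equiv.refl (ZMod q))) (fun y => chi z y)
      rw [e, sum_chi, if_neg hz]
  -- Fourier inversion. The right side keeps only `z = 0` as a possibly positive term; the left is
  -- bounded below by its diagonal.
  have e : (q : ℝ) ^ (n * 2) * ∑ x ∈ A, ∑ y ∈ A, f (swapBlocks (y - x)) =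
      ∑ z, F z * Complex.normSq (S z) := by
    have : (((q : ℝ) ^ (n * 2) * ∑ x ∈ A, ∑ y ∈ A, f (swapBlocks (y - x)) : ℝ) : ℂ) =
        ((∑ z, F z * Complex.normSq (S z) : ℝ) : ℂ) := by
      push_cast
      simp only [hS]
      rw [← sum_mul_normSq]
      simp only [← chi_sub_right, hF, sum_fourier_mul_chi, Finset.mul_sum, neg_sub]
      simp only [swapBlocks_sub]
    exact_mod_cast this
  have h1 : ∑ z, F z * Complex.normSq (S z) ≤ F 0 * (A.card : ℝ) ^ 2 := by
    rw [← Finset.add_sum_erase _ _ (Finset.mem_univ 0)]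
    have h2 : Complex.normSq (S 0) = (A.card : ℝ) ^ 2 := by simp [hS, sq]
    rw [h2]
    refine add_le_of_nonpos_right (Finset.sum_nonpos fun z hz => ?_)
    rcases Nat.lt_or_ge t (weight z) with h | h
    · exact mul_nonpos_of_nonpos_of_nonneg (hFd z h) (Complex.normSq_nonneg _)
    · rw [hS0 z (Finset.ne_of_mem_erase hz) h]
      simp
  have h2 : A.card * f 0 ≤ ∑ x ∈ A, ∑ y ∈ A, f (swapBlocks (y - x)) := by
    rw [← nsmul_eq_mul]
    refine Finset.card_nsmul_le_sum _ _ _ fun x hx => ?_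
    have h3 := Finset.single_le_sum (f := fun y => f (swapBlocks (y - x))) (fun y _ => hf _) hx
    simpa [show swapBlocks (0 : Space q n 2) = 0 from rfl] using h3
  have h3 := mul_le_mul_of_nonneg_left h2 (by positivity : (0 : ℝ) ≤ (q : ℝ) ^ (n * 2))
  refine le_of_mul_le_mul_left ?_ hpos
  linarith

end Characters


/-! ### Shapes and the averaging operator. -/

open ComplexConjugate

section Shapes

variable {q n : ℕ}

lemma blockWeight_eq (b : Fin 2 → ZMod q) :
    blockWeight b = if b 1 = 0 then (if b 0 = 0 then 0 else 1) else 2 := by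
  rw [blockWeight, show (Finset.univ : Finset (Fin 2)) = {0, 1} from rfl, Finset.filter_insert,
    Finset.filter_singleton]
  by_cases h0 : b 0 = 0 <;> by_cases h1 : b 1 = 0 <;> simp [h0, h1]

lemma blockWeight_le (b : Fin 2 → ZMod q) : blockWeight b ≤ 2 := by
  rw [blockWeight_eq]
  split_ifs <;> omega

lemma sum_comp_blockWeight (z : Space q n 2) (g : ℕ → ℝ) :
    ∑ i, g (blockWeight (z i)) =
      ((n : ℝ) - shape z 0 - shape z 1) * g 0 + shape z 0 * g 1 + shape z 1 * g 2 := by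
  have h : ∀ i, g (blockWeight (z i)) = g 0 + (if blockWeight (z i) = 1 then g 1 - g 0 else 0)
      + (if blockWeight (z i) = 2 then g 2 - g 0 else 0) := by
    intro i
    have := blockWeight_le (z i)
    interval_cases blockWeight (z i) <;> simp
  simp only [h, Finset.sum_add_distrib, ← Finset.sum_filter, Finset.sum_const, nsmul_eq_mul,
    Finset.card_univ, Fintype.card_fin]
  simp only [shape, Fin.val_zero, Fin.val_one, zero_add, Nat.reduceAdd]
  ring

lemma shape_add_le (z : Space q n 2) : shape z 0 + shape z 1 ≤ n := by
  have h := Finset.card_le_univ ((Finset.univ.filter fun i : Fin n => blockWeight (z i) = 1) ∪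
    (Finset.univ.filter fun i : Fin n => blockWeight (z i) = 2))
  rw [Finset.card_union_of_disjoint, Fintype.card_fin] at h
  · exact h
  · refine Finset.disjoint_filter.2 fun i _ h1 h2 => ?_
    omega

lemma weight_eq (z : Space q n 2) : weight z = shape z 0 + 2 * shape z 1 := by
  simp [weight, Fin.sum_univ_two]

lemma sum_blockWeight (z : Space q n 2) : ∑ i, (blockWeight (z i) : ℝ) = weight z := by
  rw [sum_comp_blockWeight z (fun m => (m : ℝ)), weight_eq]
  push_cast
  ring

lemma card_leftHull (z : Space q n 2) : (leftHull z).card = weight z := by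
  have h : (leftHull z).card = ∑ i, blockWeight (z i) := by
    rw [leftHull, Finset.card_filter, Fintype.sum_prod_type]
    refine Finset.sum_congr rfl fun i _ => ?_
    rw [← Finset.card_filter]
    have := blockWeight_le (z i)
    have h : blockWeight (z i) = 0 ∨ blockWeight (z i) = 1 ∨ blockWeight (z i) = 2 := by omega
    rcases h with h | h | h <;> simp only [h] <;> rfl
  have h2 := sum_blockWeight z
  rw [h]
  exact_mod_cast h2

lemma shape_neg (z : Space q n 2) : shape (-z) = shape z := by
  funext j
  simp only [shape]
  congr 1
  ext i
  simp [blockWeight]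

lemma shape_update (x : Space q n 2) (i : Fin n) (b : Fin 2 → ZMod q) (j : Fin 2) :
    shape (Function.update x i b) j + (if blockWeight (x i) = (j : ℕ) + 1 then 1 else 0) =
      shape x j + (if blockWeight b = (j : ℕ) + 1 then 1 else 0) := by
  simp only [shape, Finset.card_filter]
  rw [← Finset.add_sum_erase _ _ (Finset.mem_univ i),
    ← Finset.add_sum_erase Finset.univ (fun a => if blockWeight (x a) = (j : ℕ) + 1 then 1 else 0)
      (Finset.mem_univ i), Function.update_self]
  have h : ∑ a ∈ Finset.univ.erase i,
      (if blockWeight (Function.update x i b a) = (j : ℕ) + 1 then 1 else 0) =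
      ∑ a ∈ Finset.univ.erase i, (if blockWeight (x a) = (j : ℕ) + 1 then 1 else 0) := by
    refine Finset.sum_congr rfl fun a ha => ?_
    rw [Function.update_of_ne (Finset.ne_of_mem_erase ha)]
  rw [h]
  ring

/-- A function of the shape. -/
def ofShape (φ : ℕ → ℕ → ℝ) (x : Space q n 2) : ℝ := φ (shape x 0) (shape x 1)

/-- The value of a function of the shape after a block of weight `m` is replaced by a block of
weight `l`. -/
def replaced (φ : ℕ → ℕ → ℝ) (i j m l : ℕ) : ℝ :=
  φ (i - (if m = 1 then 1 else 0) + (if l = 1 then 1 else 0))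
    (j - (if m = 2 then 1 else 0) + (if l = 2 then 1 else 0))

lemma ofShape_update (φ : ℕ → ℕ → ℝ) (x : Space q n 2) (i : Fin n) (b : Fin 2 → ZMod q) :
    ofShape φ (Function.update x i b) =
      replaced φ (shape x 0) (shape x 1) (blockWeight (x i)) (blockWeight b) := by
  have h0 := shape_update x i b 0
  have h1 := shape_update x i b 1
  have hle : ∀ j : Fin 2, (if blockWeight (x i) = (j : ℕ) + 1 then 1 else 0) ≤ shape x j := by
    intro j
    split_ifs with h
    · exact Finset.card_pos.2 ⟨i, by simp [h]⟩
    · exact Nat.zero_le _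
  have l0 := hle 0
  have l1 := hle 1
  simp only [Fin.val_zero, Fin.val_one, zero_add, Nat.reduceAdd] at h0 h1 l0 l1
  rw [ofShape, replaced]
  congr 1 <;> omega

variable [NeZero q]

lemma sum_ite_zero (a b : ℝ) : ∑ s : ZMod q, (if s = 0 then a else b) = a + ((q : ℝ) - 1) * b := by
  rw [← Finset.add_sum_erase _ _ (Finset.mem_univ (0 : ZMod q)), if_pos rfl]
  congr 1
  have h : ∀ s ∈ Finset.univ.erase (0 : ZMod q), (if s = 0 then a else b) = b := fun s hs =>
    if_neg (Finset.ne_of_mem_erase hs)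
  rw [Finset.sum_congr rfl h, Finset.sum_const, Finset.card_erase_of_mem (Finset.mem_univ _),
    Finset.card_univ, ZMod.card, nsmul_eq_mul, Nat.cast_sub (Nat.one_le_iff_ne_zero.2 (NeZero.ne q)),
    Nat.cast_one]

lemma sum_block (g : ℕ → ℝ) :
    ∑ b : Fin 2 → ZMod q, g (blockWeight b) =
      g 0 + ((q : ℝ) - 1) * g 1 + q * ((q : ℝ) - 1) * g 2 := by
  rw [← Equiv.sum_comp (finTwoArrowEquiv (ZMod q)).symm, Fintype.sum_prod_type, Finset.sum_comm]
  have h : ∀ t : ZMod q, ∑ s : ZMod q,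
      g (blockWeight ((finTwoArrowEquiv (ZMod q)).symm (s, t))) =
      if t = 0 then g 0 + ((q : ℝ) - 1) * g 1 else q * g 2 := by
    intro t
    simp only [blockWeight_eq]
    by_cases ht : t = 0
    · rw [if_pos ht, ← sum_ite_zero]
      refine Finset.sum_congr rfl fun s _ => ?_
      by_cases hs : s = 0 <;> simp [hs, ht]
    · simp [ht, ZMod.card]
  simp only [h, sum_ite_zero]
  ring

lemma sum_block_left (g : ℕ → ℝ) (b : Fin 2 → ZMod q) :
    ∑ t : ZMod q, g (blockWeight (b + ![t, 0])) =
      if blockWeight b = 2 then q * g 2 else g 0 + ((q : ℝ) - 1) * g 1 := by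
  rw [← Equiv.sum_comp (Equiv.subRight (b 0))]
  simp only [blockWeight_eq]
  by_cases h1 : b 1 = 0
  · have h2 : (if b 1 = 0 then (if b 0 = 0 then 0 else 1) else 2) ≠ 2 := by
      split_ifs <;> omega
    rw [if_neg h2, ← sum_ite_zero]
    refine Finset.sum_congr rfl fun s _ => ?_
    by_cases hs : s = 0 <;> simp [hs, h1]
  · simp [h1, ZMod.card]

/-- Averaging over the blocks and over the first entries of the blocks. -/
noncomputable def blockAvg (c : Space q n 2 → ℝ) (x : Space q n 2) : ℝ :=
  ∑ i, ((q : ℝ)⁻¹ ^ 2 * ∑ b : Fin 2 → ZMod q, c (x + Pi.single i b) +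
    (q : ℝ)⁻¹ * ∑ t : ZMod q, c (x + Pi.single i ![t, 0]))

omit [NeZero q] in
lemma add_single_eq_update (x : Space q n 2) (i : Fin n) (b : Fin 2 → ZMod q) :
    x + Pi.single i b = Function.update x i (x i + b) := by
  funext k
  by_cases h : k = i
  · subst h
    simp
  · simp [Function.update_of_ne h, Pi.single_eq_of_ne h]

lemma blockAvg_ofShape (φ : ℕ → ℕ → ℝ) (x : Space q n 2) :
    blockAvg (ofShape φ) x = shapeOp q n φ (shape x 0) (shape x 1) := by
  set R := replaced φ (shape x 0) (shape x 1) with hR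
  obtain ⟨G, hG⟩ : ∃ G : ℕ → ℝ, G = fun m =>
      (q : ℝ)⁻¹ ^ 2 * (R m 0 + ((q : ℝ) - 1) * R m 1 + q * ((q : ℝ) - 1) * R m 2) +
        (q : ℝ)⁻¹ * (if m = 2 then q * R m 2 else R m 0 + ((q : ℝ) - 1) * R m 1) := ⟨_, rfl⟩
  have h : ∀ i, ((q : ℝ)⁻¹ ^ 2 * ∑ b : Fin 2 → ZMod q, ofShape φ (x + Pi.single i b) +
      (q : ℝ)⁻¹ * ∑ t : ZMod q, ofShape φ (x + Pi.single i ![t, 0])) = G (blockWeight (x i)) := by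
    intro i
    simp only [add_single_eq_update, ofShape_update, ← hR, hG]
    rw [sum_block_left (R (blockWeight (x i))), ← sum_block (R (blockWeight (x i))),
      ← Equiv.sum_comp (Equiv.addLeft (x i)) fun b => R (blockWeight (x i)) (blockWeight b)]
    rfl
  have hq : (q : ℝ) ≠ 0 := by exact_mod_cast NeZero.ne q
  rw [blockAvg, Finset.sum_congr rfl fun i _ => h i, sum_comp_blockWeight, hG]
  -- With truncated subtraction `i - 1 + 1 = i` fails at `i = 0`, so the identity is stated with the
  -- factor that vanishes there.
  have r11 : (shape x 0 : ℝ) * R 1 1 = shape x 0 * φ (shape x 0) (shape x 1) := by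
    rcases h0 : shape x 0 with _ | k
    · simp
    · simp [hR, replaced, h0]
  have r22 : (shape x 1 : ℝ) * R 2 2 = shape x 1 * φ (shape x 0) (shape x 1) := by
    rcases h0 : shape x 1 with _ | k
    · simp
    · simp [hR, replaced, h0]
  have r00 : R 0 0 = φ (shape x 0) (shape x 1) := by simp [hR, replaced]
  have r01 : R 0 1 = φ (shape x 0 + 1) (shape x 1) := by simp [hR, replaced]
  have r02 : R 0 2 = φ (shape x 0) (shape x 1 + 1) := by simp [hR, replaced]
  have r10 : R 1 0 = φ (shape x 0 - 1) (shape x 1) := by simp [hR, replaced]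
  have r12 : R 1 2 = φ (shape x 0 - 1) (shape x 1 + 1) := by simp [hR, replaced]
  have r20 : R 2 0 = φ (shape x 0) (shape x 1 - 1) := by simp [hR, replaced]
  have r21 : R 2 1 = φ (shape x 0 + 1) (shape x 1 - 1) := by simp [hR, replaced]
  simp only [shapeOp, if_neg (show (0 : ℕ) ≠ 2 by decide), if_neg (show (1 : ℕ) ≠ 2 by decide),
    if_true]
  rw [r00, r01, r02, r10, r12, r20, r21]
  clear h hG G
  generalize R 1 1 = a at r11 ⊢
  generalize R 2 2 = b at r22 ⊢
  field_simp
  linear_combination (q * ((q : ℝ) - 1) + ((q : ℝ) - 1)) * r11 + q * (q + ((q : ℝ) - 1)) * r22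

lemma sum_mul_sum_translate {ι : Type*} [Fintype ι] (g c : Space q n 2 → ℝ) (k : ℝ)
    (s : ι → Space q n 2) (e : ι ≃ ι) (he : ∀ b, s (e b) = -s b) :
    ∑ x, g x * (k * ∑ b, c (x + s b)) = ∑ x, k * (∑ b, g (x + s b)) * c x := by
  simp only [Finset.mul_sum, Finset.sum_mul]
  rw [Finset.sum_comm]
  refine Eq.trans ?_ Finset.sum_comm
  rw [← Equiv.sum_comp e]
  refine Finset.sum_congr rfl fun b _ => ?_
  rw [← Equiv.sum_comp (Equiv.addRight (s b))]
  refine Finset.sum_congr rfl fun x _ => ?_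
  simp only [Equiv.coe_addRight, he, add_neg_cancel_right]
  ring

/-- The steps averaged over form sets closed under negation, so the operator is self-adjoint. -/
lemma blockAvg_symm (g c : Space q n 2 → ℝ) :
    ∑ x, g x * blockAvg c x = ∑ x, blockAvg g x * c x := by
  simp only [blockAvg]
  have h1 : ∀ x, g x * ∑ i, ((q : ℝ)⁻¹ ^ 2 * ∑ b : Fin 2 → ZMod q, c (x + Pi.single i b) +
      (q : ℝ)⁻¹ * ∑ t : ZMod q, c (x + Pi.single i ![t, 0])) =
      ∑ i, (g x * ((q : ℝ)⁻¹ ^ 2 * ∑ b : Fin 2 → ZMod q, c (x + Pi.single i b)) +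
      g x * ((q : ℝ)⁻¹ * ∑ t : ZMod q, c (x + Pi.single i ![t, 0]))) := by
    intro x
    simp only [← mul_add]
    rw [Finset.mul_sum]
  have h2 : ∀ x, (∑ i, ((q : ℝ)⁻¹ ^ 2 * ∑ b : Fin 2 → ZMod q, g (x + Pi.single i b) +
      (q : ℝ)⁻¹ * ∑ t : ZMod q, g (x + Pi.single i ![t, 0]))) * c x =
      ∑ i, ((q : ℝ)⁻¹ ^ 2 * (∑ b : Fin 2 → ZMod q, g (x + Pi.single i b)) * c x +
      (q : ℝ)⁻¹ * (∑ t : ZMod q, g (x + Pi.single i ![t, 0])) * c x) := by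
    intro x
    simp only [← add_mul]
    rw [Finset.sum_mul]
  simp only [h1, h2]
  rw [Finset.sum_comm]
  refine Eq.trans ?_ Finset.sum_comm
  refine Finset.sum_congr rfl fun i _ => ?_
  rw [Finset.sum_add_distrib, Finset.sum_add_distrib,
    sum_mul_sum_translate g c _ (fun b : Fin 2 → ZMod q => Pi.single i b) (Equiv.neg _)
      (fun b => by rw [Equiv.neg_apply, Pi.single_neg]),
    sum_mul_sum_translate g c _ (fun t : ZMod q => Pi.single i ![t, 0]) (Equiv.neg _)
      (fun t => by rw [Equiv.neg_apply, ← Pi.single_neg]; simp)]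

/-- Orthogonality makes the first average the indicator of `z i = 0`. Since the pairing is reversed,
first entries meet `z i 1`, and the second average is the indicator of `z i 1 = 0`. Together they
count down from `2` by the block weight. -/
lemma sum_conj_chi_single (i : Fin n) (z : Space q n 2) :
    (q : ℂ)⁻¹ ^ 2 * ∑ b : Fin 2 → ZMod q, conj (chi (Pi.single i b) z) +
      (q : ℂ)⁻¹ * ∑ t : ZMod q, conj (chi (Pi.single i ![t, 0]) z) =
    2 - blockWeight (z i) := by
  have hq : (q : ℂ) ≠ 0 := by exact_mod_cast NeZero.ne q
  have h1 : ∀ b : Fin 2 → ZMod q, chi (Pi.single i b) z =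
      ZMod.stdAddChar (b 0 * z i 1) * ZMod.stdAddChar (b 1 * z i 0) := by
    intro b
    rw [chi_apply, Finset.sum_eq_single i (fun j _ hj => by simp [Pi.single_eq_of_ne hj])
      (fun hi => absurd (Finset.mem_univ i) hi), AddChar.map_add_eq_mul]
    simp
  have h2 : ∀ a : ZMod q, ∑ s : ZMod q, (ZMod.stdAddChar (s * a) : ℂ) =
      if a = 0 then (q : ℂ) else 0 := by
    intro a
    rw [AddChar.sum_mulShift a (ZMod.isPrimitive_stdAddChar q), ZMod.card]
    simp
  have h3 : ∑ b : Fin 2 → ZMod q, chi (Pi.single i b) z =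
      (if z i 1 = 0 then (q : ℂ) else 0) * (if z i 0 = 0 then (q : ℂ) else 0) := by
    simp only [h1]
    rw [← h2, ← h2, Finset.sum_mul_sum, ← Equiv.sum_comp (finTwoArrowEquiv (ZMod q)).symm,
      Fintype.sum_prod_type]
    simp
  have h4 : ∑ t : ZMod q, chi (Pi.single i ![t, 0]) z = if z i 1 = 0 then (q : ℂ) else 0 := by
    simp only [h1, ← h2]
    simp
  rw [← map_sum, ← map_sum, h3, h4, blockWeight_eq]
  by_cases hz1 : z i 1 = 0 <;> by_cases hz0 : z i 0 = 0 <;> simp [hz0, hz1, hq] <;> field_simp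
  all_goals norm_num

lemma fourier_blockAvg (c : Space q n 2 → ℝ) (z : Space q n 2) :
    fourier (blockAvg c) z = (2 * n - weight z) * fourier c z := by
  have h : fourier (blockAvg c) z = ∑ i, ((q : ℂ)⁻¹ ^ 2 * ∑ b : Fin 2 → ZMod q,
      fourier (fun x => c (x + Pi.single i b)) z +
      (q : ℂ)⁻¹ * ∑ t : ZMod q, fourier (fun x => c (x + Pi.single i ![t, 0])) z) := by
    simp only [fourier, blockAvg]
    push_cast
    simp only [Finset.sum_mul, add_mul, Finset.sum_add_distrib, Finset.mul_sum]
    congr 1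
    · rw [Finset.sum_comm]
      refine Finset.sum_congr rfl fun i _ => ?_
      rw [Finset.sum_comm]
      simp only [mul_assoc]
    · rw [Finset.sum_comm]
      refine Finset.sum_congr rfl fun i _ => ?_
      rw [Finset.sum_comm]
      simp only [mul_assoc]
  rw [h]
  simp only [fourier_translate, ← Finset.sum_mul, ← mul_assoc, ← add_mul, sum_conj_chi_single]
  congr 1
  have h2 := sum_blockWeight z
  have h3 : ∑ i, (blockWeight (z i) : ℂ) = weight z := by exact_mod_cast h2
  rw [Finset.sum_sub_distrib, h3]
  simp [mul_comm]

end Shapes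


/-! ### Recurrences for the valencies. -/

section Valency

variable {q n : ℕ} [NeZero q]

/-- The number of vectors of shape `(i, j)`, as a real number. -/
noncomputable def val (q n i j : ℕ) : ℝ := valency q n ![i, j]

omit [NeZero q] in
lemma shape_eq_iff (x : Space q n 2) (i j : ℕ) :
    shape x = ![i, j] ↔ shape x 0 = i ∧ shape x 1 = j := by
  rw [funext_iff, Fin.forall_fin_two]
  rfl

open Classical in
lemma val_eq_card (i j : ℕ) :
    val q n i j = (Finset.univ.filter fun x : Space q n 2 => shape x 0 = i ∧ shape x 1 = j).card := by
  rw [val, valency, Nat.card_eq_fintype_card, Fintype.card_subtype]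
  simp only [shape_eq_iff]

open Classical in
lemma sum_indicator_mul (i j : ℕ) (φ : ℕ → ℕ → ℝ) :
    ∑ x : Space q n 2, ofShape (fun k l => if k = i ∧ l = j then 1 else 0) x *
      φ (shape x 0) (shape x 1) = val q n i j * φ i j := by
  simp only [ofShape, ite_mul, one_mul, zero_mul]
  rw [← Finset.sum_filter, val_eq_card, ← nsmul_eq_mul]
  refine Finset.sum_eq_card_nsmul fun x hx => ?_
  obtain ⟨h0, h1⟩ := (Finset.mem_filter.1 hx).2
  rw [h0, h1]

lemma sum_ofShape (φ : ℕ → ℕ → ℝ) :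
    ∑ x : Space q n 2, ofShape φ x =
      ∑ j ∈ Finset.range (n + 1), ∑ i ∈ Finset.range (n + 1), val q n i j * φ i j := by
  simp only [← sum_indicator_mul, Finset.sum_comm (t := (Finset.univ : Finset (Space q n 2)))]
  refine Finset.sum_congr rfl fun x _ => ?_
  have h := shape_add_le x
  rw [Finset.sum_eq_single (shape x 1), Finset.sum_eq_single (shape x 0)]
  · simp [ofShape]
  · intro i _ hi
    simp [ofShape, hi.symm]
  · intro hx
    exact absurd (Finset.mem_range.2 (by omega)) hx
  · intro j _ hj
    simp [ofShape, hj.symm]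
  · intro hx
    exact absurd (Finset.mem_range.2 (by omega)) hx

/-- Self-adjointness of `blockAvg`, tested on indicators of two shapes, is a detailed balance
relation. For neighbouring shapes it yields the valency recurrences without explicit multinomial
formulas. -/
lemma val_mul_shapeOp (i j k l : ℕ) :
    val q n i j * shapeOp q n (fun a b => if a = k ∧ b = l then 1 else 0) i j =
      val q n k l * shapeOp q n (fun a b => if a = i ∧ b = j then 1 else 0) k l := by
  have h := blockAvg_symm (q := q) (n := n) (ofShape fun a b => if a = i ∧ b = j then 1 else 0)
    (ofShape fun a b => if a = k ∧ b = l then 1 else 0)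
  simp only [blockAvg_ofShape] at h
  rw [sum_indicator_mul i j (shapeOp q n _)] at h
  rw [h, ← sum_indicator_mul k l (shapeOp q n _)]
  exact Finset.sum_congr rfl fun x _ => mul_comm _ _

lemma val_left (hq : 2 ≤ q) (i j : ℕ) :
    ((i : ℝ) + 1) * val q n (i + 1) j = ((n : ℝ) - i - j) * ((q : ℝ) - 1) * val q n i j := by
  have h := val_mul_shapeOp (q := q) (n := n) i j (i + 1) j
  have hq' : (2 : ℝ) ≤ q := by exact_mod_cast hq
  have e1 : shapeOp q n (fun a b => if a = i + 1 ∧ b = j then 1 else 0) i j =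
      ((q : ℝ)⁻¹ ^ 2 + (q : ℝ)⁻¹) * (((n : ℝ) - i - j) * ((q : ℝ) - 1)) := by
    have h1 : ¬ i - 1 = i + 1 := by omega
    rcases j with _ | j
    · simp [shapeOp, h1]; ring
    · simp [shapeOp, h1]; ring
  have e2 : shapeOp q n (fun a b => if a = i ∧ b = j then 1 else 0) (i + 1) j =
      ((q : ℝ)⁻¹ ^ 2 + (q : ℝ)⁻¹) * (i + 1) := by
    have h1 : ¬ i + 1 + 1 = i := by omega
    simp [shapeOp, h1]; ring
  rw [e1, e2] at h
  have hpos : ((q : ℝ)⁻¹ ^ 2 + (q : ℝ)⁻¹) ≠ 0 := by positivity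
  refine mul_left_cancel₀ hpos ?_
  linear_combination -h

lemma val_right (hq : 2 ≤ q) (i j : ℕ) :
    ((j : ℝ) + 1) * val q n i (j + 1) =
      ((n : ℝ) - i - j) * (q * ((q : ℝ) - 1)) * val q n i j := by
  have h := val_mul_shapeOp (q := q) (n := n) i j i (j + 1)
  have hq' : (2 : ℝ) ≤ q := by exact_mod_cast hq
  have e1 : shapeOp q n (fun a b => if a = i ∧ b = j + 1 then 1 else 0) i j =
      (q : ℝ)⁻¹ * (((n : ℝ) - i - j) * ((q : ℝ) - 1)) := by
    have h1 : ¬ j - 1 = j + 1 := by omega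
    rcases i with _ | i
    · simp [shapeOp, h1]; ring
    · simp [shapeOp, h1]; ring
  have e2 : shapeOp q n (fun a b => if a = i ∧ b = j then 1 else 0) i (j + 1) =
      (q : ℝ)⁻¹ ^ 2 * (j + 1) := by
    have h1 : ¬ j + 1 + 1 = j := by omega
    simp [shapeOp, h1]; ring
  rw [e1, e2] at h
  have hpos : (q : ℝ)⁻¹ ^ 2 ≠ 0 := by positivity
  refine mul_left_cancel₀ hpos ?_
  rw [show (q : ℝ)⁻¹ ^ 2 * (((n : ℝ) - i - j) * (q * ((q : ℝ) - 1)) * val q n i j) =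
    val q n i j * ((q : ℝ)⁻¹ * (((n : ℝ) - i - j) * ((q : ℝ) - 1))) by field_simp]
  linear_combination -h

lemma val_pos (hq : 2 ≤ q) : ∀ i j, i + j ≤ n → 0 < val q n i j := by
  have hq' : (2 : ℝ) ≤ q := by exact_mod_cast hq
  have hk : ∀ i j : ℕ, i + j + 1 ≤ n → (0 : ℝ) < (n : ℝ) - i - j := by
    intro i j h
    have : (i : ℝ) + j + 1 ≤ n := by exact_mod_cast h
    linarith
  intro i j
  induction j with
  | zero =>
    induction i with
    | zero =>
      intro _
      rw [val_eq_card, Nat.cast_pos, Finset.card_pos]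
      refine ⟨0, ?_⟩
      simp [shape, blockWeight]
    | succ i ih =>
      intro h
      refine pos_of_mul_pos_right (a := (i : ℝ) + 1) ?_ (by positivity)
      rw [val_left hq]
      exact mul_pos (mul_pos (hk i 0 (by omega)) (by linarith)) (ih (by omega))
  | succ j ih =>
    intro h
    refine pos_of_mul_pos_right (a := (j : ℝ) + 1) ?_ (by positivity)
    rw [val_right hq]
    exact mul_pos (mul_pos (hk i j (by omega)) (mul_pos (by linarith) (by linarith)))
      (ih (by omega))

lemma isValency_val (hq : 2 ≤ q) : IsValency q n (val q n) :=
  ⟨val_pos hq, fun i j _ => val_left hq i j, fun i j _ => val_right hq i j⟩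

end Valency

/-! ### The certificate and the point `(α, β)`. -/

/-- The linear programming certificate attached to the point `(α, β)`. -/
lemma PointData.exists_certificate {q n s₁ s₂ : ℕ} [NeZero q] {α β : ℝ}
    (H : PointData q n s₁ s₂ α β) :
    ∃ f F : Space q n 2 → ℝ, (∀ z, (F z : ℂ) = fourier f z) ∧ (∀ w, 0 ≤ f w) ∧
      (∀ z : Space q n 2, α + 2 * β ≤ weight z → F z ≤ 0) ∧ 0 ≤ F 0 ∧ 0 < f 0 ∧
      F 0 ≤ 4 * ((n : ℝ) - β - s₂) * ((n : ℝ) - s₂ - s₁ + 1) ^ 2 * ((q : ℝ) - 1) ^ 3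
            * (α + 2 * β) / ((q : ℝ) ^ 3 * α ^ 2 * β ^ 2)
          * (valency q n ![s₁ - 1, s₂] : ℝ) * f 0 := by
  have hq := H.one_lt
  have hα := H.alpha_pos
  have hβ := H.beta_pos
  have hβn : 0 < (n : ℝ) - β - s₂ := by have := H.beta_lt; linarith
  have hv := isValency_val (n := n) H.two_le
  set v := val q n with hvdef
  set φ := cutoff q n s₂ v α β with hφ
  set c : Space q n 2 → ℝ := ofShape φ with hc
  set l : ℝ := 2 * n - (α + 2 * β) with hl
  set h : Space q n 2 → ℝ := fun x => blockAvg c x - l * c x with hh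
  have hshape : ∀ x : Space q n 2, h x =
      shapeOp q n φ (shape x 0) (shape x 1) - l * φ (shape x 0) (shape x 1) := fun x => by
    rw [hh, ← blockAvg_ofShape]; rfl
  have hc0 : ∀ x, 0 ≤ c x := fun x => H.cutoff_nonneg hv _ _
  have hh0 : ∀ x, 0 ≤ h x := fun x => by
    rw [hshape]
    exact H.defect_nonneg hv (shape_add_le x)
  have hcneg : ∀ x, c (-x) = c x := fun x => by simp only [hc, ofShape, shape_neg]
  have hhneg : ∀ x, h (-x) = h x := fun x => by simp only [hshape, shape_neg]
  have hfh : ∀ z, fourier h z = (α + 2 * β - weight z) * fourier c z := by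
    intro z
    have : fourier h z = fourier (blockAvg c) z - l * fourier c z := by
      simp only [fourier, hh, Finset.mul_sum, ← Finset.sum_sub_distrib]
      refine Finset.sum_congr rfl fun x _ => ?_
      push_cast
      ring
    rw [this, fourier_blockAvg, hl]
    push_cast
    ring
  have hre : ∀ z, fourier c z = ((fourier c z).re : ℂ) := fun z =>
    (Complex.conj_eq_iff_re.1 (fourier_conj hcneg z)).symm
  set B := bivariate q n α β (s₁ - 1) s₂ with hB
  have hreg := H.region_shape
  have hvpos : 0 < v (s₁ - 1) s₂ := hv.pos _ _ hreg.2.1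
  have hBpos : 0 < B :=
    mul_pos (mul_pos (by positivity) (H.right_pos s₂ le_rfl)) hreg.pos
  have hsum : (fourier c 0).re = ∑ x, c x := by
    rw [fourier_zero, Complex.ofReal_re]
  have hsum0 : 0 ≤ ∑ x, c x := Finset.sum_nonneg fun x _ => hc0 x
  have hsumle : ∑ x, c x ≤ 2 * ((q : ℝ) - 1) ^ 2 * ((n : ℝ) - s₂ - s₁ + 1) *
      ((n : ℝ) - β - s₂) / (q ^ 2 * α * β) * B := by
    rw [hc, sum_ofShape]
    exact H.sum_cutoff_le hv
  -- All terms of `f 0` are nonnegative; only those of shape `(s₁ - 1, s₂)` are kept, and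
  -- `defect_last` bounds them. This is the source of the factor `v_s` in the result.
  have hf0 : (q : ℝ)⁻¹ * ((q : ℝ) - 1) * ((n : ℝ) - β - s₂) * B ^ 2 / v (s₁ - 1) s₂ ≤
      ∑ x, c x * h (0 - x) := by
    have e1 : ∑ x, c x * h (0 - x) = ∑ x : Space q n 2, ofShape (fun i j =>
        φ i j * (shapeOp q n φ i j - l * φ i j)) x := by
      refine Finset.sum_congr rfl fun x _ => ?_
      rw [zero_sub, hhneg, hshape]
      rfl
    have hnn : ∀ x : Space q n 2, 0 ≤ ofShape (fun i j =>
        φ i j * (shapeOp q n φ i j - l * φ i j)) x := fun x =>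
      mul_nonneg (H.cutoff_nonneg hv _ _) (H.defect_nonneg hv (shape_add_le x))
    have e2 : v (s₁ - 1) s₂ * (φ (s₁ - 1) s₂ *
        (shapeOp q n φ (s₁ - 1) s₂ - l * φ (s₁ - 1) s₂)) ≤
        ∑ x : Space q n 2, ofShape (fun i j =>
          φ i j * (shapeOp q n φ i j - l * φ i j)) x := by
      rw [hvdef, ← sum_indicator_mul (s₁ - 1) s₂ (fun i j =>
        φ i j * (shapeOp q n φ i j - l * φ i j))]
      refine Finset.sum_le_sum fun x _ => ?_
      refine mul_le_of_le_one_left (hnn x) ?_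
      simp only [ofShape]
      split_ifs <;> norm_num
    rw [e1]
    refine le_trans ?_ e2
    have e3 : φ (s₁ - 1) s₂ = B / v (s₁ - 1) s₂ := cutoff_of_region hreg
    have e4 := H.defect_last hv (i := s₁ - 1) (by have := H.one_le; omega)
    rw [← hφ, ← hl, ← hB] at e4
    have e5 : v (s₁ - 1) s₂ * φ (s₁ - 1) s₂ = B := by
      rw [e3, mul_div_cancel₀ _ hvpos.ne']
    rw [← mul_assoc, e5]
    refine le_trans (le_of_eq ?_) (mul_le_mul_of_nonneg_left e4 hBpos.le)
    ring
  refine ⟨fun w => ∑ x, c x * h (w - x),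
    fun z => (α + 2 * β - weight z) * (fourier c z).re ^ 2, fun z => ?_,
    fun w => Finset.sum_nonneg fun x _ => mul_nonneg (hc0 x) (hh0 _), fun z hz => ?_, ?_, ?_, ?_⟩
  · rw [fourier_conv, hfh, hre z]
    push_cast
    ring
  · exact mul_nonpos_of_nonpos_of_nonneg (by linarith) (sq_nonneg _)
  · have : weight (0 : Space q n 2) = 0 := by simp [weight_eq, shape, blockWeight]
    simp only [this]
    push_cast
    rw [sub_zero]
    positivity
  · have hq1 : 0 < (q : ℝ) - 1 := by linarith
    exact lt_of_lt_of_le (by positivity) hf0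
  · have : weight (0 : Space q n 2) = 0 := by simp [weight_eq, shape, blockWeight]
    simp only [this, hsum]
    have hq1 : 0 < (q : ℝ) - 1 := by linarith
    change _ ≤ _ * v (s₁ - 1) s₂ * _
    refine le_trans ?_ (mul_le_mul_of_nonneg_left hf0 (by positivity))
    refine (mul_le_mul_of_nonneg_left (pow_le_pow_left₀ hsum0 hsumle 2)
      (by push_cast; linarith)).trans (le_of_eq ?_)
    push_cast
    field_simp
    ring

lemma IsPoint.pointData {q n s₁ s₂ : ℕ} (hq : 2 ≤ q) (hs₁ : 1 ≤ s₁) (hn : s₁ + s₂ ≤ n) {α β : ℝ}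
    (H : IsPoint q n s₁ s₂ α β) : PointData q n s₁ s₂ α β := by
  obtain ⟨m, rfl⟩ := Nat.exists_eq_add_of_le' hs₁
  have hn' : (m : ℝ) + 1 + s₂ ≤ n := by exact_mod_cast hn
  have hm : (m : ℝ) < (n : ℝ) - s₂ := by linarith
  have hroot := H.beta_root
  have hβ := hroot.lt hq hm
  have hs₂ : (s₂ : ℝ) < (n : ℝ) - β := by linarith
  obtain ⟨x, hx, hxα⟩ := H.lt_alpha
  have hα : 0 < α := (hx.pos hq hs₂).trans hxα
  have hpos : ∀ j ≤ s₂, 0 < krawtchouk q j ((n : ℝ) - β) α := by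
    intro j hj
    rcases s₂ with _ | k
    · obtain rfl : j = 0 := by omega
      simp
    · have hk : (k : ℝ) < (n : ℝ) - β := by
        push_cast at hs₂
        linarith
      obtain ⟨r, -, hr, hle, hlt⟩ := exists_isFirstRoot hq k hk
      have hαr := H.alpha_lt r hr
      rcases Nat.lt_or_ge j (k + 1) with h | h
      · exact hle α hαr.le j (by omega)
      · obtain rfl : j = k + 1 := by omega
        exact hlt α hαr
  refine ⟨hq, hs₁, hn, hα, hroot.pos hq hm, hβ, hroot.1,
    fun i hi => hroot.pos_of_le hq hm le_rfl (by omega), hpos, ?_⟩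
  have h0 := krawtchouk_pos_of_nonpos hq le_rfl s₂ (N := (n : ℝ) - β) (by linarith)
  have h1 := hpos s₂ le_rfl
  -- At `x = 0` the left side vanishes, which evaluates `W 0` as `(q - 1) (n - β - s₂) / (s₂ + 1)`.
  have h2 := sum_krawtchouk q s₂ ((n : ℝ) - β) 0
  have h3 := H.balance
  rw [mul_zero, zero_mul] at h2
  rw [← neg_div, div_eq_div_iff h1.ne' h0.ne'] at h3
  refine mul_right_cancel₀ h0.ne' ?_
  linear_combination ((s₂ : ℝ) + 1) * h3 - krawtchouk q s₂ ((n : ℝ) - β) α * h2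

lemma exists_isPoint {q n s₁ s₂ : ℕ} (hq : 2 ≤ q) (hs₁ : 1 ≤ s₁) (hn : s₁ + s₂ ≤ n) :
    ∃ α β : ℝ, IsPoint q n s₁ s₂ α β := by
  have hq' : (2 : ℝ) ≤ q := by exact_mod_cast hq
  obtain ⟨m, rfl⟩ := Nat.exists_eq_add_of_le' hs₁
  have hn' : (m : ℝ) + 1 + s₂ ≤ n := by exact_mod_cast hn
  have hm : (m : ℝ) < (n : ℝ) - s₂ := by linarith
  obtain ⟨β, -, hroot, -, -⟩ := exists_isFirstRoot hq m hm
  have hβ := hroot.lt hq hm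
  have hs₂ : (s₂ : ℝ) < (n : ℝ) - β := by linarith
  obtain ⟨N, hN⟩ : ∃ N, N = (n : ℝ) - β := ⟨_, rfl⟩
  rw [← hN] at hs₂
  obtain ⟨x, hx0, hx, hxle, -⟩ := exists_isFirstRoot hq s₂ hs₂
  have hx1 : krawtchouk q (s₂ + 1) N x = 0 := hx.1
  have h0 := krawtchouk_pos_of_nonpos hq le_rfl s₂ (N := N) (by linarith)
  have h0' := krawtchouk_pos_of_nonpos hq le_rfl (s₂ + 1) (N := N) (by push_cast; linarith)
  set W := krawtchouk q (s₂ + 1) N 0 / krawtchouk q s₂ N 0 with hW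
  have hWpos : 0 < W := div_pos h0' h0
  suffices h : ∃ α, x < α ∧ (∀ y, IsFirstRoot q s₂ N y → α < y) ∧
      krawtchouk q (s₂ + 1) N α / krawtchouk q s₂ N α = -W by
    obtain ⟨α, h1, h2, h3⟩ := h
    refine ⟨α, β, hroot, ?_, ?_, ?_⟩ <;> rw [← hN]
    · exact ⟨x, hx, h1⟩
    · exact h2
    · exact h3
  rcases s₂ with _ | k
  · have hxe : q * x = ((q : ℝ) - 1) * N := by
      rw [krawtchouk_one] at hx1
      linarith
    -- For `s₂ = 0` the balance equation is linear: `k_1` takes opposite values at `0` and at twice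
    -- its root.
    refine ⟨2 * x, by linarith, fun y hy => ?_, ?_⟩
    · have := hy.1
      simp at this
    · rw [hW]
      simp only [zero_add, krawtchouk_one, krawtchouk_zero]
      linear_combination (-2 : ℝ) * hxe
  · have hk : (k : ℝ) < N := by
      push_cast at hs₂
      linarith
    obtain ⟨r, hr0, hr, hle, hlt⟩ := exists_isFirstRoot hq k hk
    have hr1 : krawtchouk q (k + 1) N r = 0 := hr.1
    have hxr : x < r := by
      by_contra hc
      exact (hxle r (not_lt.1 hc) (k + 1) le_rfl).ne' hr1
    have hrneg : krawtchouk q (k + 2) N r < 0 := by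
      have h1 := krawtchouk_add_two q k N r
      rw [hr1, mul_zero, zero_sub] at h1
      have h2 : 0 < ((q : ℝ) - 1) * (N - k) * krawtchouk q k N r :=
        mul_pos (mul_pos (by linarith) (by linarith)) (hle r le_rfl k le_rfl)
      by_contra hc
      have h3 : 0 ≤ ((k : ℝ) + 2) * krawtchouk q (k + 2) N r :=
        mul_nonneg (by positivity) (not_lt.1 hc)
      linarith
    -- Balance without denominators. The function is positive at `x`, where only the second term
    -- survives, and negative at `r`, where only the first does; a zero strictly between is the
    -- required `α`.
    have hcont : ContinuousOn (fun y => krawtchouk q (k + 2) N y + W * krawtchouk q (k + 1) N y)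
        (Set.Icc x r) :=
      ((continuous_krawtchouk q (k + 2) N).add
        (continuous_const.mul (continuous_krawtchouk q (k + 1) N))).continuousOn
    have hxpos := hxle x le_rfl (k + 1) le_rfl
    obtain ⟨α, ⟨h1, h2⟩, h3⟩ := intermediate_value_Ioo' hxr.le hcont
      (show (0 : ℝ) ∈ Set.Ioo _ _ from ⟨by simpa [hr1] using hrneg, by
        change 0 < krawtchouk q (k + 1 + 1) N x + _
        rw [hx1, zero_add]
        exact mul_pos hWpos hxpos⟩)
    refine ⟨α, h1, fun y hy => ?_, ?_⟩
    · rwa [hy.unique hr]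
    · rw [div_eq_iff (hlt α h2).ne']
      change krawtchouk q (k + 2) N α + W * krawtchouk q (k + 1) N α = 0 at h3
      change krawtchouk q (k + 2) N α = _
      linarith

end NRT

theorem theorem6p2 (q n s₁ s₂ : ℕ) (hq : 2 ≤ q) (hs₁ : 1 ≤ s₁)
    (hΔ : {![s₁ - 1, s₂ + 1], ![s₁, s₂]} ⊆ NRT.Shapes 2 n) :
    (∃ α β : ℝ, NRT.IsPoint q n s₁ s₂ α β) ∧
    ∀ (α β : ℝ) (d : ℕ), NRT.IsPoint q n s₁ s₂ α β → α + 2 * β ≤ d →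
      (∀ (C : Finset (NRT.Space q n 2)) (M : ℕ), NRT.IsCode C M d →
        (M : ℝ) ≤ 4 * ((n : ℝ) - β - s₂) * ((n : ℝ) - s₂ - s₁ + 1) ^ 2 * ((q : ℝ) - 1) ^ 3
            * (α + 2 * β) / ((q : ℝ) ^ 3 * α ^ 2 * β ^ 2)
          * (NRT.valency q n ![s₁ - 1, s₂] : ℝ)) ∧
      (∀ (A : Finset (NRT.Space q n 2)) (t M : ℕ), d = t + 1 → NRT.IsOOA A t M →
        (q : ℝ) ^ (n * 2) / (NRT.valency q n ![s₁ - 1, s₂] : ℝ)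
            * ((q : ℝ) ^ 3 * α ^ 2 * β ^ 2
              / (4 * ((n : ℝ) - β - s₂) * ((n : ℝ) - s₂ - s₁ + 1) ^ 2 * ((q : ℝ) - 1) ^ 3
                * (α + 2 * β))) ≤ (M : ℝ)) := by
  have hn : s₁ + s₂ ≤ n := by
    have h : ∑ j, (![s₁, s₂] : Fin 2 → ℕ) j ≤ n := hΔ (by simp)
    simpa [Fin.sum_univ_two] using h
  have : NeZero q := ⟨by omega⟩
  refine ⟨NRT.exists_isPoint hq hs₁ hn, fun α β d hpt hd => ?_⟩
  have H := hpt.pointData hq hs₁ hn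
  obtain ⟨f, F, hF, hf, hneg, hF0, hf0, hle⟩ := H.exists_certificate
  have hFd : ∀ z : NRT.Space q n 2, d ≤ NRT.weight z → F z ≤ 0 := fun z hz =>
    hneg z (hd.trans (by exact_mod_cast hz))
  refine ⟨fun C M hC => ?_, fun A t M hdt hA => ?_⟩
  · refine le_of_mul_le_mul_right ?_ hf0
    rw [mul_comm (M : ℝ)]
    exact (NRT.code_bound hF hf hFd hF0 hC).trans hle
  · subst hdt
    have h1 := NRT.ooa_bound hF hf hFd NRT.card_leftHull hA
    set K : ℝ := 4 * ((n : ℝ) - β - s₂) * ((n : ℝ) - s₂ - s₁ + 1) ^ 2 * ((q : ℝ) - 1) ^ 3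
      * (α + 2 * β) with hK
    have hq1 := H.one_lt
    have hα := H.alpha_pos
    have hβ := H.beta_pos
    have hKpos : 0 < K := by
      have h2 : 0 < (n : ℝ) - β - s₂ := by have := H.beta_lt; linarith
      have h3 : 0 < (n : ℝ) - s₂ - s₁ + 1 := by
        have : (s₁ : ℝ) + s₂ ≤ n := by exact_mod_cast hn
        linarith
      have h4 : 0 < (q : ℝ) - 1 := by linarith
      positivity
    have hv : 0 < (NRT.valency q n ![s₁ - 1, s₂] : ℝ) :=
      NRT.val_pos hq (s₁ - 1) s₂ (by omega)
    set v : ℝ := (NRT.valency q n ![s₁ - 1, s₂] : ℝ) with hvdef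
    have h5 : (q : ℝ) ^ (n * 2) ≤ K / ((q : ℝ) ^ 3 * α ^ 2 * β ^ 2) * v * M := by
      refine le_of_mul_le_mul_right (h1.trans ?_) hf0
      refine (mul_le_mul_of_nonneg_right hle (Nat.cast_nonneg M)).trans (le_of_eq ?_)
      ring
    rw [div_mul_div_comm, div_le_iff₀ (mul_pos hv hKpos)]
    have h6 : 0 < (q : ℝ) ^ 3 * α ^ 2 * β ^ 2 := by positivity
    refine (mul_le_mul_of_nonneg_right h5 h6.le).trans (le_of_eq ?_)
    field_simp
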